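/- Let $\mathbf k$ be a field, let $H_0$ be a Hopf algebra over $\mathbf k$ with bijective antipode $S$, and let $V=V_1\oplus\dots\oplus V_d$ be a direct sum of left-left Yetter–Drinfeld modules over $H_0$. The tensor algebra $TV$ carries the diagonal action and coaction of $H_0$ and the braiding $c(x\otimes y)=x_{(-1)}.y\otimes x_{(0)}$, with inverse $c^{-1}(x\otimes y)=y_{(0)}\otimes S^{-1}(y_{(-1)}).x$; put $[x,y]=xy-\mathrm m\,c^{-1}(x\otimes y)$, where $\mathrm m$ is the multiplication of $TV$. Let $L$ be the set of Lyndon words in the letters $1<\dots<d$, that is, of the nonempty words $u$ that are lexicographically smaller than each of their proper nonempty right factors, ordered lexicographically (a proper prefix of a word is smaller than the word). For a word $u=a_1\cdots a_r$ put $V^u=V_{a_1}\otimes\dots\otimes V_{a_r}$. For $u\in L$ define $x\mapsto[x]$, $V^u\to TV$, inductively: $[x]=x$ if $r=1$, and if $r\ge 2$, then $[x]=[[x_v],[x_w]]$, where $u=vw$ with $w$ the longest proper right factor of $u$ that lies in $L$, and $x=x_v\otimes x_w$ (in general a sum of tensors) under $V^u\simeq V^v\otimes V^w$. Let $V^{[u]}\subseteq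 TV$ be the image of this map; it is a Yetter–Drinfeld submodule. For a Yetter–Drinfeld module $W$ write $T^+W=\bigoplus_{n\ge 1}W^{\otimes n}$. Then the map $$\mu:\ \bigoplus_{r\ge 1}\ \bigoplus_{u_1>\dots>u_r\text{ in }L} T^+V^{[u_1]}\otimes\dots\otimes T^+V^{[u_r]}\ \longrightarrow\ T^+V,$$ which is the multiplication map of $TV$ on each summand, is an isomorphism of Yetter–Drinfeld modules over $H_0$. If moreover all $V_i$ are finite-dimensional, then the Hilbert series satisfy $$\eta(TV,t)=\prod_{u\in L}\eta(TV^{[u]},t),$$ where $TV$ is graded with $V$ in degree $1$, the algebra $TV^{[u]}$, regarded as a subalgebra of $TV$, has the induced grading, $\eta(A,t)=\sum_{n\ge 0}\dim(A_n)\,t^n$, and the (in general infinite) product converges coefficientwise in $\mathbb Z[[t]]$. -/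

import Mathlib

open scoped TensorProduct PowerSeries.WithPiTopology
open Coalgebra

universe u v

noncomputable section

namespace YetterDrinfeld

section Auxiliary

variable (k : Type u) (H : Type v) (M N : Type u) [Field k] [Ring H] [HopfAlgebra k H]
  [AddCommGroup M] [Module k M] [AddCommGroup N] [Module k N]

theorem lift_zero_apply {P Q R : Type*} [AddCommGroup P] [AddCommGroup Q] [AddCommGroup R]
    [Module k P] [Module k Q] [Module k R] (d : P ⊗[k] Q) :
    TensorProduct.lift (0 : P →ₗ[k] Q →ₗ[k] R) d = 0 := by
  induction d with
  | zero => simp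
  | add x y hx hy => simp only [map_add, hx, hy, add_zero]
  | tmul x y => simp

theorem lift_add_apply {P Q R : Type*} [AddCommGroup P] [AddCommGroup Q] [AddCommGroup R]
    [Module k P] [Module k Q] [Module k R] (f g : P →ₗ[k] Q →ₗ[k] R) (d : P ⊗[k] Q) :
    TensorProduct.lift (f + g) d = TensorProduct.lift f d + TensorProduct.lift g d := by
  induction d with
  | zero => simp
  | add x y hx hy => simp only [map_add, hx, hy]; abel
  | tmul x y => simp

/-- The bilinear map `(g ⊗ m, h) ↦ g h ⊗ m`. -/
def mulRightFirst : H ⊗[k] M →ₗ[k] H →ₗ[k] H ⊗[k] M :=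
  (LinearMap.rTensorHom M ∘ₗ (LinearMap.mul k H).flip).flip

@[simp] theorem mulRightFirst_tmul (g : H) (m : M) (h : H) :
    mulRightFirst k H M (g ⊗ₜ m) h = (g * h) ⊗ₜ m := by
  simp [mulRightFirst]

/-- The bilinear map `(g ⊗ m, g' ⊗ n) ↦ g g' ⊗ (m ⊗ n)`. -/
def mulFirst : (H ⊗[k] M) →ₗ[k] (H ⊗[k] N) →ₗ[k] H ⊗[k] (M ⊗[k] N) :=
  TensorProduct.map₂ (LinearMap.mul k H) (TensorProduct.mk k M N)

@[simp] theorem mulFirst_tmul (g g' : H) (m : M) (n : N) :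
    mulFirst k H M N (g ⊗ₜ m) (g' ⊗ₜ n) = (g * g') ⊗ₜ (m ⊗ₜ n) := by
  simp [mulFirst]

variable {k H M N}

/-- The coaction `v ⊗ w ↦ v₍₋₁₎ w₍₋₁₎ ⊗ (v₍₀₎ ⊗ w₍₀₎)` on a tensor product. -/
def tensorCoact (δ : M →ₗ[k] H ⊗[k] M) (ε : N →ₗ[k] H ⊗[k] N) :
    M ⊗[k] N →ₗ[k] H ⊗[k] (M ⊗[k] N) :=
  TensorProduct.lift ((mulFirst k H M N).compl₁₂ δ ε)

@[simp] theorem tensorCoact_tmul (δ : M →ₗ[k] H ⊗[k] M) (ε : N →ₗ[k] H ⊗[k] N) (v : M) (w : N) :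
    tensorCoact δ ε (v ⊗ₜ w) = mulFirst k H M N (δ v) (ε w) := by
  simp [tensorCoact]

/-- The diagonal action `h ↦ (v ⊗ w ↦ h₍₁₎.v ⊗ h₍₂₎.w)` on a tensor product. -/
def tensorAct (a : H →ₐ[k] Module.End k M) (b : H →ₐ[k] Module.End k N) :
    H →ₐ[k] Module.End k (M ⊗[k] N) :=
  (Module.endTensorEndAlgHom (A := k)).comp
    ((Algebra.TensorProduct.map a b).comp (Bialgebra.comulAlgHom k H))

theorem tensorAct_tmul (a : H →ₐ[k] Module.End k M) (b : H →ₐ[k] Module.End k N) (h : H)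
    (m : M) (n : N) :
    tensorAct a b h (m ⊗ₜ n) =
      TensorProduct.map (a.toLinearMap.flip m) (b.toLinearMap.flip n) (comul (R := k) h) := by
  simp only [tensorAct, AlgHom.comp_apply, Bialgebra.comulAlgHom_apply]
  induction comul (R := k) h with
  | zero => simp
  | add x y hx hy => simp only [map_add, LinearMap.add_apply, hx, hy]
  | tmul x y => simp [Module.endTensorEndAlgHom_apply]

/-- The compatibility condition for a tensor product, at a pure tensor. -/
theorem compat_aux (a : H →ₐ[k] Module.End k M) (b : H →ₐ[k] Module.End k N)
    (δ : M →ₗ[k] H ⊗[k] M) (ε : N →ₗ[k] H ⊗[k] N) (v : M) (w : N)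
    (hv : ∀ h, TensorProduct.map₂ (LinearMap.mul k H) a.toLinearMap (comul (R := k) h) (δ v) =
      TensorProduct.lift (mulRightFirst k H M ∘ₗ δ ∘ₗ a.toLinearMap.flip v) (comul (R := k) h))
    (hw : ∀ h, TensorProduct.map₂ (LinearMap.mul k H) b.toLinearMap (comul (R := k) h) (ε w) =
      TensorProduct.lift (mulRightFirst k H N ∘ₗ ε ∘ₗ b.toLinearMap.flip w) (comul (R := k) h))
    (h : H) :
    TensorProduct.map₂ (LinearMap.mul k H) (tensorAct a b).toLinearMap (comul (R := k) h)
        (mulFirst k H M N (δ v) (ε w)) =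
      TensorProduct.lift (mulRightFirst k H (M ⊗[k] N) ∘ₗ tensorCoact δ ε ∘ₗ
        (tensorAct a b).toLinearMap.flip (v ⊗ₜ w)) (comul (R := k) h) := by
  set Rv := TensorProduct.lift (mulRightFirst k H M ∘ₗ δ ∘ₗ a.toLinearMap.flip v) with hRv
  set Rw := TensorProduct.lift (mulRightFirst k H N ∘ₗ ε ∘ₗ b.toLinearMap.flip w) with hRw
  let F1 : H ⊗[k] M → H ⊗[k] N → (H ⊗[k] H) ⊗[k] H →ₗ[k] H ⊗[k] (M ⊗[k] N) := fun t s =>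
    TensorProduct.lift ((mulFirst k H M N).compl₁₂
      ((TensorProduct.map₂ (LinearMap.mul k H) a.toLinearMap).flip t)
      ((LinearMap.lTensorHom H ∘ₗ b.toLinearMap).flip s))
  let F2 : H ⊗[k] N → (H ⊗[k] H) ⊗[k] H →ₗ[k] H ⊗[k] (M ⊗[k] N) := fun s =>
    TensorProduct.lift ((mulFirst k H M N).compl₁₂ Rv
      ((LinearMap.lTensorHom H ∘ₗ b.toLinearMap).flip s))
  let F3 : H ⊗[k] N → H ⊗[k] (H ⊗[k] H) →ₗ[k] H ⊗[k] (M ⊗[k] N) := fun s =>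
    TensorProduct.lift ((mulFirst k H M N).compl₁₂ (δ ∘ₗ a.toLinearMap.flip v)
      ((TensorProduct.map₂ (LinearMap.mul k H) b.toLinearMap).flip s))
  let F4 : H ⊗[k] (H ⊗[k] H) →ₗ[k] H ⊗[k] (M ⊗[k] N) :=
    TensorProduct.lift ((mulFirst k H M N).compl₁₂ (δ ∘ₗ a.toLinearMap.flip v) Rw)
  have sA : ∀ (d : H ⊗[k] H) t s,
      TensorProduct.map₂ (LinearMap.mul k H) (tensorAct a b).toLinearMap d (mulFirst k H M N t s)
        = F1 t s ((TensorProduct.assoc k H H H).symm ((comul (R := k) (A := H)).lTensor H d)) := by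
    intro d t s
    induction d with
    | zero => simp
    | add x y hx hy => simp only [map_add, LinearMap.add_apply, hx, hy]
    | tmul h1 h =>
      induction t with
      | zero =>
        have : F1 0 s = 0 := by ext; simp [F1]
        simp [this]
      | add x y hx hy =>
        have : F1 (x + y) s = F1 x s + F1 y s := by
          apply TensorProduct.ext'; intro x' y'; simp [F1]
        simp only [map_add, LinearMap.add_apply, hx, hy, this]
      | tmul g m =>
        induction s with
        | zero =>
          have : F1 (g ⊗ₜ m) 0 = 0 := by ext; simp [F1]
          simp [this]
        | add x y hx hy =>
          have : F1 (g ⊗ₜ m) (x + y) = F1 (g ⊗ₜ m) x + F1 (g ⊗ₜ m) y := by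
            apply TensorProduct.ext'; intro x' y'; simp [F1]
          simp only [map_add, LinearMap.add_apply, hx, hy, this]
        | tmul g' n =>
          simp only [mulFirst_tmul, TensorProduct.map₂_apply_tmul, LinearMap.lTensor_tmul,
            AlgHom.toLinearMap_apply, LinearMap.mul_apply_apply, TensorProduct.map_tmul]
          rw [tensorAct_tmul]
          induction comul (R := k) h with
          | zero => simp
          | add x y hx hy => simp only [map_add, TensorProduct.tmul_add, hx, hy]
          | tmul x y => simp [F1, mul_assoc]
  have sC : ∀ d : H ⊗[k] H, F1 (δ v) (ε w) ((comul (R := k) (A := H)).rTensor H d) =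
      F2 (ε w) ((comul (R := k) (A := H)).rTensor H d) := by
    intro d
    induction d with
    | zero => simp
    | add x y hx hy => simp only [map_add, hx, hy]
    | tmul x y => simp [F1, F2, hv]
  have sD : ∀ (s) (x : (H ⊗[k] H) ⊗[k] H), F2 s x = F3 s (TensorProduct.assoc k H H H x) := by
    intro s x
    induction x with
    | zero => simp
    | add x y hx hy => simp only [map_add, hx, hy]
    | tmul e h3 =>
      induction e with
      | zero => simp
      | add x y hx hy => simp only [map_add, TensorProduct.add_tmul, hx, hy]
      | tmul h1 h2 =>
        simp only [F2, F3, hRv, TensorProduct.lift.tmul, LinearMap.compl₁₂_apply,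
          TensorProduct.assoc_tmul, LinearMap.comp_apply, LinearMap.flip_apply]
        induction δ (a.toLinearMap h1 v) with
        | zero => simp
        | add x y hx hy => simp only [map_add, LinearMap.add_apply, hx, hy]
        | tmul g m =>
          induction s with
          | zero => simp
          | add x y hx hy => simp only [map_add, hx, hy]
          | tmul g' n => simp [mul_assoc]
  have sF : ∀ d : H ⊗[k] H, F3 (ε w) ((comul (R := k) (A := H)).lTensor H d) =
      F4 ((comul (R := k) (A := H)).lTensor H d) := by
    intro d
    induction d with
    | zero => simp
    | add x y hx hy => simp only [map_add, hx, hy]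
    | tmul x y => simp [F3, F4, hw]
  have sG : ∀ d : H ⊗[k] H, TensorProduct.lift (mulRightFirst k H (M ⊗[k] N) ∘ₗ
      tensorCoact δ ε ∘ₗ (tensorAct a b).toLinearMap.flip (v ⊗ₜ w)) d =
      F4 (TensorProduct.assoc k H H H ((comul (R := k) (A := H)).rTensor H d)) := by
    intro d
    induction d with
    | zero => simp
    | add x y hx hy => simp only [map_add, hx, hy]
    | tmul h1 h3 =>
      simp only [TensorProduct.lift.tmul, LinearMap.comp_apply, LinearMap.flip_apply,
        AlgHom.toLinearMap_apply, tensorAct_tmul, LinearMap.rTensor_tmul]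
      induction comul (R := k) h1 with
      | zero => simp
      | add x y hx hy => simp only [map_add, TensorProduct.add_tmul, LinearMap.add_apply, hx, hy]
      | tmul p q =>
        simp only [F4, hRw, TensorProduct.map_tmul, tensorCoact_tmul, TensorProduct.assoc_tmul,
          TensorProduct.lift.tmul, LinearMap.compl₁₂_apply, LinearMap.comp_apply,
          LinearMap.flip_apply]
        induction δ (a.toLinearMap p v) with
        | zero => simp
        | add x y hx hy => simp only [map_add, LinearMap.add_apply, hx, hy]
        | tmul g m =>
          induction ε (b.toLinearMap q w) with
          | zero => simp
          | add x y hx hy => simp only [map_add, LinearMap.add_apply, hx, hy]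
          | tmul g' n => simp [mul_assoc]
  rw [sA, coassoc_symm_apply, sC, sD, coassoc_apply, sF, sG, coassoc_apply]

/-- The bilinear map `(g ⊗ h ⊗ m, g' ⊗ h' ⊗ n) ↦ g g' ⊗ h h' ⊗ (m ⊗ n)`. -/
def mulFirst₂ : H ⊗[k] (H ⊗[k] M) →ₗ[k] H ⊗[k] (H ⊗[k] N) →ₗ[k] H ⊗[k] (H ⊗[k] (M ⊗[k] N)) :=
  TensorProduct.map₂ (LinearMap.mul k H) (mulFirst k H M N)

theorem assoc_comul_mulFirst (t : H ⊗[k] M) (s : H ⊗[k] N) :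
    TensorProduct.assoc k H H _ ((comul (R := k) (A := H)).rTensor _ (mulFirst k H M N t s)) =
      mulFirst₂ (TensorProduct.assoc k H H _ ((comul (R := k) (A := H)).rTensor _ t))
        (TensorProduct.assoc k H H _ ((comul (R := k) (A := H)).rTensor _ s)) := by
  induction t with
  | zero => simp
  | add x y hx hy => simp only [map_add, LinearMap.add_apply, hx, hy]
  | tmul g m =>
    induction s with
    | zero => simp
    | add x y hx hy => simp only [map_add, hx, hy]
    | tmul g' n =>
      simp only [mulFirst_tmul, LinearMap.rTensor_tmul, Bialgebra.comul_mul]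
      induction comul (R := k) g with
      | zero => simp
      | add x y hx hy =>
        simp only [map_add, add_mul, TensorProduct.add_tmul, LinearMap.add_apply, hx, hy]
      | tmul p q =>
        induction comul (R := k) g' with
        | zero => simp
        | add x y hx hy => simp only [map_add, mul_add, TensorProduct.add_tmul, hx, hy]
        | tmul p' q' => simp [mulFirst₂]

theorem lTensor_tensorCoact_mulFirst (δ : M →ₗ[k] H ⊗[k] M) (ε : N →ₗ[k] H ⊗[k] N)
    (t : H ⊗[k] M) (s : H ⊗[k] N) :
    (tensorCoact δ ε).lTensor H (mulFirst k H M N t s) =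
      mulFirst₂ (δ.lTensor H t) (ε.lTensor H s) := by
  induction t with
  | zero => simp
  | add x y hx hy => simp only [map_add, LinearMap.add_apply, hx, hy]
  | tmul g m =>
    induction s with
    | zero => simp
    | add x y hx hy => simp only [map_add, hx, hy]
    | tmul g' n => simp [mulFirst₂]

theorem counit_mulFirst (t : H ⊗[k] M) (s : H ⊗[k] N) :
    TensorProduct.lid k _ ((counit (R := k) (A := H)).rTensor _ (mulFirst k H M N t s)) =
      TensorProduct.lid k _ ((counit (R := k) (A := H)).rTensor _ t) ⊗ₜ
        TensorProduct.lid k _ ((counit (R := k) (A := H)).rTensor _ s) := by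
  induction t with
  | zero => simp
  | add x y hx hy => simp only [map_add, LinearMap.add_apply, TensorProduct.add_tmul, hx, hy]
  | tmul g m =>
    induction s with
    | zero => simp
    | add x y hx hy => simp only [map_add, TensorProduct.tmul_add, hx, hy]
    | tmul g' n => simp [mul_smul, TensorProduct.smul_tmul', smul_comm (counit (R := k) g)]

/-- The axioms of a left-left Yetter-Drinfeld module for an action `a` and a coaction `δ`, at the
vector `v`: coassociativity and counitality of `δ`, and the compatibility condition
`h₍₁₎ v₍₋₁₎ ⊗ h₍₂₎.v₍₀₎ = (h₍₁₎.v)₍₋₁₎ h₍₂₎ ⊗ (h₍₁₎.v)₍₀₎` for all `h`. -/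
structure AxiomsAt (a : H →ₐ[k] Module.End k M) (δ : M →ₗ[k] H ⊗[k] M) (v : M) : Prop where
  coassoc : TensorProduct.assoc k H H M ((comul (R := k) (A := H)).rTensor M (δ v)) =
    δ.lTensor H (δ v)
  counit_coact : TensorProduct.lid k M ((counit (R := k) (A := H)).rTensor M (δ v)) = v
  compat : ∀ h : H,
    TensorProduct.map₂ (LinearMap.mul k H) a.toLinearMap (comul (R := k) h) (δ v) =
      TensorProduct.lift (mulRightFirst k H M ∘ₗ δ ∘ₗ a.toLinearMap.flip v) (comul (R := k) h)

section AxiomsAt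

variable {a : H →ₐ[k] Module.End k M} {δ : M →ₗ[k] H ⊗[k] M}
  {b : H →ₐ[k] Module.End k N} {ε : N →ₗ[k] H ⊗[k] N}

theorem AxiomsAt.zero : AxiomsAt a δ 0 where
  coassoc := by simp
  counit_coact := by simp
  compat h := by simp [lift_zero_apply]

theorem AxiomsAt.add {v w : M} (hv : AxiomsAt a δ v) (hw : AxiomsAt a δ w) :
    AxiomsAt a δ (v + w) where
  coassoc := by simp only [map_add, hv.coassoc, hw.coassoc]
  counit_coact := by simp only [map_add, hv.counit_coact, hw.counit_coact]
  compat h := by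
    simp only [map_add, LinearMap.comp_add, lift_add_apply, hv.compat, hw.compat]

theorem AxiomsAt.tmul {v : M} {w : N} (hv : AxiomsAt a δ v) (hw : AxiomsAt b ε w) :
    AxiomsAt (tensorAct a b) (tensorCoact δ ε) (v ⊗ₜ w) where
  coassoc := by
    rw [tensorCoact_tmul, assoc_comul_mulFirst, hv.coassoc, hw.coassoc,
      lTensor_tensorCoact_mulFirst]
  counit_coact := by rw [tensorCoact_tmul, counit_mulFirst, hv.counit_coact, hw.counit_coact]
  compat h := by
    rw [tensorCoact_tmul]
    exact compat_aux _ _ _ _ _ _ hv.compat hw.compat h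

theorem assoc_comul_lTensor (f : M →ₗ[k] N) (t : H ⊗[k] M) :
    TensorProduct.assoc k H H N ((comul (R := k) (A := H)).rTensor N (f.lTensor H t)) =
      (f.lTensor H).lTensor H
        (TensorProduct.assoc k H H M ((comul (R := k) (A := H)).rTensor M t)) := by
  induction t with
  | zero => simp
  | add x y hx hy => simp only [map_add, hx, hy]
  | tmul h m =>
    simp only [LinearMap.lTensor_tmul, LinearMap.rTensor_tmul]
    induction comul (R := k) h with
    | zero => simp
    | add x y hx hy => simp only [map_add, TensorProduct.add_tmul, hx, hy]
    | tmul p q => simp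

theorem counit_lTensor (f : M →ₗ[k] N) (t : H ⊗[k] M) :
    TensorProduct.lid k N ((counit (R := k) (A := H)).rTensor N (f.lTensor H t)) =
      f (TensorProduct.lid k M ((counit (R := k) (A := H)).rTensor M t)) := by
  induction t with
  | zero => simp
  | add x y hx hy => simp only [map_add, hx, hy]
  | tmul h m => simp

theorem map₂_lTensor {f : M →ₗ[k] N} (hf : ∀ h v, f (a h v) = b h (f v)) (d : H ⊗[k] H)
    (t : H ⊗[k] M) :
    TensorProduct.map₂ (LinearMap.mul k H) b.toLinearMap d (f.lTensor H t) =
      f.lTensor H (TensorProduct.map₂ (LinearMap.mul k H) a.toLinearMap d t) := by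
  induction d with
  | zero => simp
  | add x y hx hy => simp only [map_add, LinearMap.add_apply, hx, hy]
  | tmul p q =>
    induction t with
    | zero => simp
    | add x y hx hy => simp only [map_add, hx, hy]
    | tmul h m => simp [hf]

theorem mulRightFirst_lTensor (f : M →ₗ[k] N) (t : H ⊗[k] M) (h : H) :
    mulRightFirst k H N (f.lTensor H t) h = f.lTensor H (mulRightFirst k H M t h) := by
  induction t with
  | zero => simp
  | add x y hx hy => simp only [map_add, LinearMap.add_apply, hx, hy]
  | tmul p q => simp

theorem lift_lTensor {f : M →ₗ[k] N} (hf : ∀ h v, f (a h v) = b h (f v))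
    (hf' : ∀ v, ε (f v) = f.lTensor H (δ v)) (v : M) (d : H ⊗[k] H) :
    TensorProduct.lift (mulRightFirst k H N ∘ₗ ε ∘ₗ b.toLinearMap.flip (f v)) d =
      f.lTensor H (TensorProduct.lift (mulRightFirst k H M ∘ₗ δ ∘ₗ a.toLinearMap.flip v) d) := by
  induction d with
  | zero => simp
  | add x y hx hy => simp only [map_add, hx, hy]
  | tmul p q => simp [← hf, hf', mulRightFirst_lTensor]

theorem lTensor_lTensor {f : M →ₗ[k] N} (hf' : ∀ v, ε (f v) = f.lTensor H (δ v)) (t : H ⊗[k] M) :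
    ε.lTensor H (f.lTensor H t) = (f.lTensor H).lTensor H (δ.lTensor H t) := by
  rw [← LinearMap.comp_apply, ← LinearMap.comp_apply, ← LinearMap.lTensor_comp,
    ← LinearMap.lTensor_comp]
  congr 2
  ext v
  exact hf' v

theorem AxiomsAt.map {f : M →ₗ[k] N} (hf : ∀ h v, f (a h v) = b h (f v))
    (hf' : ∀ v, ε (f v) = f.lTensor H (δ v)) {v : M} (hv : AxiomsAt a δ v) :
    AxiomsAt b ε (f v) where
  coassoc := by rw [hf', assoc_comul_lTensor, hv.coassoc, lTensor_lTensor hf']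
  counit_coact := by rw [hf', counit_lTensor, hv.counit_coact]
  compat h := by rw [hf', map₂_lTensor hf, hv.compat, lift_lTensor hf hf']

theorem AxiomsAt.of_map {f : M →ₗ[k] N} (hi : Function.Injective f)
    (hf : ∀ h v, f (a h v) = b h (f v))
    (hf' : ∀ v, ε (f v) = f.lTensor H (δ v)) {v : M} (hv : AxiomsAt b ε (f v)) :
    AxiomsAt a δ v where
  coassoc := by
    have := hv.coassoc
    rw [hf', assoc_comul_lTensor, lTensor_lTensor hf'] at this
    exact Module.Flat.lTensor_preserves_injective_linearMap _
      (Module.Flat.lTensor_preserves_injective_linearMap _ hi) this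
  counit_coact := by
    have := hv.counit_coact
    rw [hf', counit_lTensor] at this
    exact hi this
  compat h := by
    have := hv.compat h
    rw [hf', map₂_lTensor hf, lift_lTensor hf hf'] at this
    exact Module.Flat.lTensor_preserves_injective_linearMap _ hi this

end AxiomsAt

end Auxiliary

/-- Left-left Yetter-Drinfeld modules over the Hopf algebra `H`: a vector space with a left action
`act` and a left coaction `coact` of `H` that satisfy the comodule axioms and the compatibility
condition at every vector. -/
structure YDMod (k : Type u) (H : Type v) [Field k] [Ring H] [HopfAlgebra k H] where
  carrier : Type u
  [addCommGroup : AddCommGroup carrier]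
  [module : Module k carrier]
  act : H →ₐ[k] Module.End k carrier
  coact : carrier →ₗ[k] H ⊗[k] carrier
  axiomsAt : ∀ v, AxiomsAt act coact v

attribute [instance] YDMod.addCommGroup YDMod.module

variable {k : Type u} {H : Type v} [Field k] [Ring H] [HopfAlgebra k H]

instance : CoeSort (YDMod k H) (Type u) := ⟨YDMod.carrier⟩

/-- The tensor product of Yetter-Drinfeld modules. -/
abbrev YDMod.tensor (M N : YDMod k H) : YDMod k H where
  carrier := M ⊗[k] N
  act := tensorAct M.act N.act
  coact := tensorCoact M.coact N.coact
  axiomsAt v := by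
    induction v with
    | zero => exact .zero
    | add x y hx hy => exact hx.add hy
    | tmul v w => exact (M.axiomsAt v).tmul (N.axiomsAt w)

/-- The unit object: the field with trivial action and coaction. -/
abbrev YDMod.unit (k : Type u) (H : Type v) [Field k] [Ring H] [HopfAlgebra k H] : YDMod k H where
  carrier := k
  act := (Algebra.ofId k (Module.End k k)).comp (Bialgebra.counitAlgHom k H)
  coact := TensorProduct.mk k H k 1
  axiomsAt v :=
    { coassoc := by simp [Algebra.TensorProduct.one_def]
      counit_coact := by simp
      compat := by
        intro h
        have (d : H ⊗[k] H) : TensorProduct.map₂ (LinearMap.mul k H)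
            ((Algebra.ofId k (Module.End k k)).comp (Bialgebra.counitAlgHom k H)).toLinearMap d
              (TensorProduct.mk k H k 1 v) =
            ((TensorProduct.rid k H) ((counit (R := k) (A := H)).lTensor H d)) ⊗ₜ v := by
          induction d with
          | zero => simp
          | add x y hx hy =>
            simp only [map_add, LinearMap.add_apply, TensorProduct.add_tmul, hx, hy]
          | tmul x y => simp [Algebra.ofId_apply, TensorProduct.smul_tmul]
        rw [this]
        have (d : H ⊗[k] H) : TensorProduct.lift (mulRightFirst k H k ∘ₗ
            TensorProduct.mk k H k 1 ∘ₗ ((Algebra.ofId k (Module.End k k)).comp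
              (Bialgebra.counitAlgHom k H)).toLinearMap.flip v) d =
            ((TensorProduct.lid k H) ((counit (R := k) (A := H)).rTensor H d)) ⊗ₜ v := by
          induction d with
          | zero => simp
          | add x y hx hy => simp only [map_add, TensorProduct.add_tmul, hx, hy]
          | tmul x y => simp [Algebra.ofId_apply, TensorProduct.smul_tmul]
        rw [this]
        simp }

/-- The direct sum of a family of Yetter-Drinfeld modules. -/
abbrev YDMod.directSum {ι : Type} [DecidableEq ι] (V : ι → YDMod k H) : YDMod k H where
  carrier := DirectSum ι fun i => V i
  act := AlgHom.ofLinearMap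
    (LinearMap.mk₂ k (fun h x => DirectSum.lmap (fun i => (V i).act h) x)
      (by
        intro h h' x
        induction x using DirectSum.induction_on with
        | zero => simp
        | of i x => simp [← DirectSum.lof_eq_of k]
        | add x y hx hy => rw [map_add, map_add, map_add, hx, hy]; abel)
      (by
        intro c h x
        induction x using DirectSum.induction_on with
        | zero => simp
        | of i x => simp [← DirectSum.lof_eq_of k]
        | add x y hx hy => rw [map_add, map_add, hx, hy, smul_add])
      (by simp) (by simp))
    (by
      ext i x : 2
      simp)
    (by
      intro g h
      ext i x : 2
      simp)
  coact := DirectSum.toModule k ι _ fun i =>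
    (DirectSum.lof k ι (fun i => (V i).carrier) i).lTensor H ∘ₗ (V i).coact
  axiomsAt v := by
    induction v using DirectSum.induction_on with
    | zero => exact .zero
    | of i x =>
      rw [← DirectSum.lof_eq_of k]
      refine AxiomsAt.map (f := DirectSum.lof k ι (fun i => (V i).carrier) i) ?_ ?_
        ((V i).axiomsAt x)
      · intro h v
        simp
      · intro v
        simp
    | add x y hx hy => exact hx.add hy

section Sub

/-- The submodule `N` is a Yetter-Drinfeld submodule, that is, stable under action and coaction. -/
structure YDMod.IsSub (M : YDMod k H) (N : Submodule k M) : Prop where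
  act_mem : ∀ h, ∀ x ∈ N, M.act h x ∈ N
  coact_mem : ∀ x ∈ N, M.coact x ∈ LinearMap.range (N.subtype.lTensor H)

variable {M : YDMod k H} {N : Submodule k M}

theorem lTensor_subtype_injective (N : Submodule k M) :
    Function.Injective (N.subtype.lTensor H) :=
  Module.Flat.lTensor_preserves_injective_linearMap _ N.injective_subtype

/-- The restriction of the coaction to a Yetter-Drinfeld submodule. -/
def subCoact (hN : M.IsSub N) : N →ₗ[k] H ⊗[k] N :=
  (LinearEquiv.ofInjective (N.subtype.lTensor H) (lTensor_subtype_injective N)).symm.toLinearMap ∘ₗ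
    (M.coact ∘ₗ N.subtype).codRestrict _ fun x => hN.coact_mem x x.2

theorem lTensor_subCoact (hN : M.IsSub N) (x : N) :
    N.subtype.lTensor H (subCoact hN x) = M.coact x := by
  have := LinearEquiv.apply_symm_apply
    (LinearEquiv.ofInjective (N.subtype.lTensor H) (lTensor_subtype_injective N))
    ((M.coact ∘ₗ N.subtype).codRestrict _ (fun x => hN.coact_mem x x.2) x)
  exact congrArg Subtype.val this

/-- A Yetter-Drinfeld submodule as a Yetter-Drinfeld module. -/
abbrev YDMod.sub (M : YDMod k H) (N : Submodule k M) (hN : M.IsSub N) : YDMod k H where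
  carrier := N
  act :=
    { toFun := fun h => (M.act h).restrict (hN.act_mem h)
      map_one' := by ext; simp
      map_mul' := fun g h => by ext; simp
      map_zero' := by ext; simp
      map_add' := fun g h => by ext; simp
      commutes' := fun c => by ext; simp }
  coact := subCoact hN
  axiomsAt v := by
    refine AxiomsAt.of_map N.injective_subtype (b := M.act) (ε := M.coact) ?_ ?_ (M.axiomsAt v)
    · intro h v
      rfl
    · intro v
      exact (lTensor_subCoact hN v).symm

end Sub

/-- Morphisms of Yetter-Drinfeld modules: linear and colinear maps. -/
structure YDHom (M N : YDMod k H) where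
  toLin : M →ₗ[k] N
  map_act : ∀ h v, toLin (M.act h v) = N.act h (toLin v)
  map_coact : ∀ v, N.coact (toLin v) = toLin.lTensor H (M.coact v)

/-- Isomorphisms of Yetter-Drinfeld modules. -/
structure YDIso (M N : YDMod k H) where
  toEquiv : M ≃ₗ[k] N
  map_act : ∀ h v, toEquiv (M.act h v) = N.act h (toEquiv v)
  map_coact : ∀ v, N.coact (toEquiv v) = toEquiv.toLinearMap.lTensor H (M.coact v)

namespace YDHom

variable {M N P Q : YDMod k H}

/-- Composition. -/
def comp (g : YDHom N P) (f : YDHom M N) : YDHom M P where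
  toLin := g.toLin ∘ₗ f.toLin
  map_act h v := by simp [f.map_act, g.map_act]
  map_coact v := by
    rw [LinearMap.comp_apply, g.map_coact, f.map_coact, LinearMap.lTensor_comp,
      LinearMap.comp_apply]

/-- The identity. -/
def id (M : YDMod k H) : YDHom M M where
  toLin := LinearMap.id
  map_act _ _ := rfl
  map_coact v := by simp

/-- Difference of two morphisms. -/
def sub (f g : YDHom M N) : YDHom M N where
  toLin := f.toLin - g.toLin
  map_act h v := by simp [f.map_act, g.map_act]
  map_coact v := by simp [f.map_coact, g.map_coact, LinearMap.lTensor_sub]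

theorem mulFirst_lTensor {M N P Q : Type u} [AddCommGroup M] [Module k M] [AddCommGroup N]
    [Module k N] [AddCommGroup P] [Module k P] [AddCommGroup Q] [Module k Q]
    (f : M →ₗ[k] N) (g : P →ₗ[k] Q) (t : H ⊗[k] M) (s : H ⊗[k] P) :
    mulFirst k H N Q (f.lTensor H t) (g.lTensor H s) =
      (TensorProduct.map f g).lTensor H (mulFirst k H M P t s) := by
  induction t with
  | zero => simp
  | add x y hx hy => simp only [map_add, LinearMap.add_apply, hx, hy]
  | tmul h m =>
    induction s with
    | zero => simp
    | add x y hx hy => simp only [map_add, hx, hy]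
    | tmul g n => simp

/-- The tensor product of two morphisms. -/
def tensor (f : YDHom M N) (g : YDHom P Q) : YDHom (M.tensor P) (N.tensor Q) where
  toLin := TensorProduct.map f.toLin g.toLin
  map_act h v := by
    induction v using TensorProduct.induction_on with
    | zero => simp
    | add x y hx hy => simp only [map_add, hx, hy]
    | tmul x y =>
      rw [TensorProduct.map_tmul, tensorAct_tmul, tensorAct_tmul, ← LinearMap.comp_apply,
        ← TensorProduct.map_comp]
      congr 2 <;> ext h <;> simp [f.map_act, g.map_act]
  map_coact v := by
    induction v using TensorProduct.induction_on with
    | zero => simp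
    | add x y hx hy => simp only [map_add, hx, hy]
    | tmul x y =>
      rw [TensorProduct.map_tmul, tensorCoact_tmul, tensorCoact_tmul, f.map_coact, g.map_coact,
        mulFirst_lTensor]

/-- The inclusion of a Yetter-Drinfeld submodule. -/
def subtype {N : Submodule k M} (hN : M.IsSub N) : YDHom (M.sub N hN) M where
  toLin := N.subtype
  map_act _ _ := rfl
  map_coact v := (lTensor_subCoact hN v).symm

theorem isSub_range (f : YDHom M N) : N.IsSub (LinearMap.range f.toLin) where
  act_mem := by
    rintro h _ ⟨x, rfl⟩
    exact ⟨M.act h x, f.map_act h x⟩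
  coact_mem := by
    rintro _ ⟨x, rfl⟩
    refine ⟨f.toLin.rangeRestrict.lTensor H (M.coact x), ?_⟩
    rw [← LinearMap.comp_apply, ← LinearMap.lTensor_comp, f.map_coact]
    rfl

/-- The image of a morphism. -/
abbrev range (f : YDHom M N) : YDMod k H := N.sub (LinearMap.range f.toLin) f.isSub_range

/-- The canonical isomorphism `M → k ⊗ M`. -/
def leftUnitorInv (M : YDMod k H) : YDHom M ((YDMod.unit k H).tensor M) where
  toLin := (TensorProduct.lid k M).symm.toLinearMap
  map_act h v := by
    have (d : H ⊗[k] H) : TensorProduct.map ((YDMod.unit k H).act.toLinearMap.flip 1)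
        (M.act.toLinearMap.flip v) d =
        (1 : k) ⊗ₜ M.act (TensorProduct.lid k H ((counit (R := k) (A := H)).rTensor H d)) v := by
      induction d with
      | zero => simp
      | add x y hx hy =>
        simp only [map_add, LinearMap.add_apply, TensorProduct.tmul_add, hx, hy]
      | tmul x y => simp [Algebra.ofId_apply, TensorProduct.smul_tmul']
    rw [LinearEquiv.coe_coe, TensorProduct.lid_symm_apply, TensorProduct.lid_symm_apply,
      tensorAct_tmul, this, rTensor_counit_comul, TensorProduct.lid_tmul, one_smul]
  map_coact v := by
    simp only [LinearEquiv.coe_coe, TensorProduct.lid_symm_apply, tensorCoact_tmul]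
    induction M.coact v with
    | zero => simp
    | add x y hx hy => simp only [map_add, hx, hy]
    | tmul x y => simp

/-- The canonical isomorphism `M ⊗ (N ⊗ P) → (M ⊗ N) ⊗ P`. -/
def assocInv (M N P : YDMod k H) : YDHom (M.tensor (N.tensor P)) ((M.tensor N).tensor P) where
  toLin := (TensorProduct.assoc k M N P).symm.toLinearMap
  map_act h v := by
    induction v using TensorProduct.induction_on with
    | zero => simp
    | add x y hx hy => simp only [map_add, hx, hy]
    | tmul x v =>
      induction v using TensorProduct.induction_on with
      | zero => simp
      | add y z hy hz => simp only [map_add, TensorProduct.tmul_add, hy, hz]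
      | tmul y z =>
        have h1 (d : H ⊗[k] H) : (TensorProduct.assoc k M N P).symm
            (TensorProduct.map (M.act.toLinearMap.flip x)
              ((N.tensor P).act.toLinearMap.flip (y ⊗ₜ z)) d) =
            TensorProduct.map (TensorProduct.map (M.act.toLinearMap.flip x)
              (N.act.toLinearMap.flip y)) (P.act.toLinearMap.flip z)
              ((TensorProduct.assoc k H H H).symm ((comul (R := k) (A := H)).lTensor H d)) := by
          induction d with
          | zero => simp
          | add x y hx hy => simp only [map_add, hx, hy]
          | tmul p q =>
            simp only [TensorProduct.map_tmul, LinearMap.flip_apply, AlgHom.toLinearMap_apply,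
              tensorAct_tmul, LinearMap.lTensor_tmul]
            induction comul (R := k) q with
            | zero => simp
            | add x y hx hy => simp only [map_add, TensorProduct.tmul_add, hx, hy]
            | tmul q r => simp
        have h2 (d : H ⊗[k] H) : TensorProduct.map
            ((M.tensor N).act.toLinearMap.flip (x ⊗ₜ y)) (P.act.toLinearMap.flip z) d =
            TensorProduct.map (TensorProduct.map (M.act.toLinearMap.flip x)
              (N.act.toLinearMap.flip y)) (P.act.toLinearMap.flip z)
              ((comul (R := k) (A := H)).rTensor H d) := by
          induction d with
          | zero => simp
          | add x y hx hy => simp only [map_add, hx, hy]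
          | tmul p q => simp [tensorAct_tmul]
        rw [tensorAct_tmul, LinearEquiv.coe_coe, TensorProduct.assoc_symm_tmul, tensorAct_tmul,
          h1, h2, coassoc_symm_apply]
  map_coact v := by
    induction v using TensorProduct.induction_on with
    | zero => simp
    | add x y hx hy => simp only [map_add, hx, hy]
    | tmul x v =>
      induction v using TensorProduct.induction_on with
      | zero => simp
      | add y z hy hz => simp only [map_add, TensorProduct.tmul_add, hy, hz]
      | tmul y z =>
        simp only [LinearEquiv.coe_coe, TensorProduct.assoc_symm_tmul, tensorCoact_tmul]
        induction M.coact x with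
        | zero => simp
        | add x y hx hy => simp only [map_add, LinearMap.add_apply, hx, hy]
        | tmul p x =>
          induction N.coact y with
          | zero => simp
          | add x y hx hy => simp only [map_add, LinearMap.add_apply, hx, hy]
          | tmul q y =>
            induction P.coact z with
            | zero => simp
            | add x y hx hy => simp only [map_add, hx, hy]
            | tmul r z => simp [mul_assoc]

end YDHom

section Braiding

variable (M N : YDMod k H)

/-- The braiding `c(x ⊗ y) = x₍₋₁₎.y ⊗ x₍₀₎`. -/
def braidingLin : M ⊗[k] N →ₗ[k] N ⊗[k] M :=
  TensorProduct.lift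
    (((LinearMap.rTensorHom M ∘ₗ N.act.toLinearMap.flip).flip) ∘ₗ M.coact)

theorem braidingLin_tmul (x : M) (y : N) :
    braidingLin M N (x ⊗ₜ y) = (N.act.toLinearMap.flip y).rTensor M (M.coact x) := by
  simp [braidingLin]

/-- The map `x ⊗ y ↦ y₍₀₎ ⊗ T(y₍₋₁₎).x`; for `T` the inverse of the antipode this is the inverse
of the braiding. -/
def braidingInvLin (T : H →ₗ[k] H) : N ⊗[k] M →ₗ[k] M ⊗[k] N :=
  TensorProduct.lift
    (((LinearMap.rTensorHom M ∘ₗ (LinearMap.lcomp k N T ∘ₗ N.act.toLinearMap.flip)).compr₂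
      (TensorProduct.comm k N M).toLinearMap).compl₂ M.coact)

theorem braidingInvLin_tmul (T : H →ₗ[k] H) (x : N) (y : M) :
    braidingInvLin M N T (x ⊗ₜ y) = TensorProduct.comm k N M
      ((N.act.toLinearMap.flip x ∘ₗ T).rTensor M (M.coact y)) := by
  simp [braidingInvLin]
  rfl

/-- The inverse of the antipode. -/
def antipodeInv (hS : Function.Bijective (HopfAlgebra.antipode k (A := H))) : H →ₗ[k] H :=
  (LinearEquiv.ofBijective (HopfAlgebra.antipode k (A := H)) hS).symm.toLinearMap

section
variable (hS : Function.Bijective (HopfAlgebra.antipode k (A := H)))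

theorem antipode_antipodeInv (h : H) : HopfAlgebra.antipode k (antipodeInv hS h) = h :=
  LinearEquiv.apply_symm_apply (LinearEquiv.ofBijective (HopfAlgebra.antipode k (A := H)) hS) h

theorem antipode_algebraMap (c : k) :
    HopfAlgebra.antipode k (algebraMap k H c) = algebraMap k H c := by
  rw [Algebra.algebraMap_eq_smul_one, map_smul, HopfAlgebra.antipode_one]

/-- `h₍₂₎ S⁻¹(h₍₁₎) = ε(h) 1`. -/
theorem mul_antipodeInv (h : H) :
    LinearMap.mul' k H (TensorProduct.comm k H H ((antipodeInv hS).rTensor H (comul (R := k) h)))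
      = algebraMap k H (counit h) := by
  apply hS.1
  rw [antipode_algebraMap, ← HopfAlgebra.mul_antipode_lTensor_comul_apply]
  induction comul (R := k) h with
  | zero => simp
  | add x y hx hy => simp only [map_add, hx, hy]
  | tmul x y => simp [HopfAlgebra.antipode_mul_antidistrib, antipode_antipodeInv]

/-- `S⁻¹(h₍₂₎) h₍₁₎ = ε(h) 1`. -/
theorem antipodeInv_mul (h : H) :
    LinearMap.mul' k H (TensorProduct.comm k H H ((antipodeInv hS).lTensor H (comul (R := k) h)))
      = algebraMap k H (counit h) := by
  apply hS.1
  rw [antipode_algebraMap, ← HopfAlgebra.mul_antipode_rTensor_comul_apply]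
  induction comul (R := k) h with
  | zero => simp
  | add x y hx hy => simp only [map_add, hx, hy]
  | tmul x y => simp [HopfAlgebra.antipode_mul_antidistrib, antipode_antipodeInv]

theorem counit_act_tmul (M N : YDMod k H) (x : N) (y : M) :
    TensorProduct.map ((N.act.toLinearMap.flip x) ∘ₗ Algebra.linearMap k H ∘ₗ
      counit (R := k) (A := H)) LinearMap.id (M.coact y) = x ⊗ₜ[k] y := by
  have (t : H ⊗[k] M) : TensorProduct.map ((N.act.toLinearMap.flip x) ∘ₗ Algebra.linearMap k H ∘ₗ
      counit (R := k) (A := H)) LinearMap.id t =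
      x ⊗ₜ[k] TensorProduct.lid k M ((counit (R := k) (A := H)).rTensor M t) := by
    induction t with
    | zero => simp
    | add x y hx hy => simp only [map_add, TensorProduct.tmul_add, hx, hy]
    | tmul x y => simp [Algebra.algebraMap_eq_smul_one, TensorProduct.smul_tmul']
  rw [this, (M.axiomsAt y).counit_coact]

theorem braidingLin_braidingInvLin (x : N ⊗[k] M) :
    braidingLin M N (braidingInvLin M N (antipodeInv hS) x) = x := by
  induction x with
  | zero => simp
  | add x y hx hy => simp only [map_add, hx, hy]
  | tmul x y =>
    have h1 (t : H ⊗[k] M) : braidingLin M N (TensorProduct.comm k N M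
        ((N.act.toLinearMap.flip x ∘ₗ antipodeInv hS).rTensor M t)) =
        TensorProduct.map ((N.act.toLinearMap.flip x) ∘ₗ LinearMap.mul' k H ∘ₗ
          (TensorProduct.comm k H H).toLinearMap ∘ₗ (antipodeInv hS).rTensor H) LinearMap.id
          ((TensorProduct.assoc k H H M).symm (M.coact.lTensor H t)) := by
      induction t with
      | zero => simp
      | add x y hx hy => simp only [map_add, hx, hy]
      | tmul h m =>
        simp only [LinearMap.rTensor_tmul, TensorProduct.comm_tmul, braidingLin_tmul,
          LinearMap.lTensor_tmul]
        induction M.coact m with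
        | zero => simp
        | add x y hx hy => simp only [map_add, TensorProduct.tmul_add, hx, hy]
        | tmul g m => simp
    rw [braidingInvLin_tmul, h1, ← (M.axiomsAt y).coassoc, LinearEquiv.symm_apply_apply,
      ← LinearMap.comp_apply, LinearMap.map_comp_rTensor,
      ← counit_act_tmul]
    congr 2
    ext h
    simpa using congrArg (fun g => N.act g x) (mul_antipodeInv hS h)

theorem braidingInvLin_braidingLin (x : M ⊗[k] N) :
    braidingInvLin M N (antipodeInv hS) (braidingLin M N x) = x := by
  induction x with
  | zero => simp
  | add x y hx hy => simp only [map_add, hx, hy]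
  | tmul y x =>
    have h1 (t : H ⊗[k] M) : TensorProduct.comm k M N (braidingInvLin M N (antipodeInv hS)
        ((N.act.toLinearMap.flip x).rTensor M t)) =
        TensorProduct.map ((N.act.toLinearMap.flip x) ∘ₗ LinearMap.mul' k H ∘ₗ
          (TensorProduct.comm k H H).toLinearMap ∘ₗ (antipodeInv hS).lTensor H) LinearMap.id
          ((TensorProduct.assoc k H H M).symm (M.coact.lTensor H t)) := by
      induction t with
      | zero => simp
      | add x y hx hy => simp only [map_add, hx, hy]
      | tmul h m =>
        simp only [LinearMap.rTensor_tmul, braidingInvLin_tmul,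
          LinearMap.lTensor_tmul]
        induction M.coact m with
        | zero => simp
        | add x y hx hy => simp only [map_add, TensorProduct.tmul_add, hx, hy]
        | tmul g m => simp
    apply (TensorProduct.comm k M N).injective
    rw [braidingLin_tmul, h1, ← (M.axiomsAt y).coassoc, LinearEquiv.symm_apply_apply,
      ← LinearMap.comp_apply, LinearMap.map_comp_rTensor,
      TensorProduct.comm_tmul, ← counit_act_tmul]
    congr 2
    ext h
    simpa using congrArg (fun g => N.act g x) (antipodeInv_mul hS h)

theorem braidingLin_act (h : H) (z : M ⊗[k] N) :
    braidingLin M N ((M.tensor N).act h z) = (N.tensor M).act h (braidingLin M N z) := by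
  induction z with
  | zero => simp
  | add x y hx hy => simp only [map_add, hx, hy]
  | tmul v w =>
    have h1 (d : H ⊗[k] H) : braidingLin M N (TensorProduct.map (M.act.toLinearMap.flip v)
        (N.act.toLinearMap.flip w) d) = (N.act.toLinearMap.flip w).rTensor M
        (TensorProduct.lift (mulRightFirst k H M ∘ₗ M.coact ∘ₗ M.act.toLinearMap.flip v) d) := by
      induction d with
      | zero => simp
      | add x y hx hy => simp only [map_add, hx, hy]
      | tmul p q =>
        simp only [TensorProduct.map_tmul, braidingLin_tmul, TensorProduct.lift.tmul,
          LinearMap.comp_apply]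
        induction M.coact (M.act.toLinearMap.flip v p) with
        | zero => simp
        | add x y hx hy => simp only [map_add, LinearMap.add_apply, hx, hy]
        | tmul g m => simp
    have h2 (t : H ⊗[k] M) : (N.act.toLinearMap.flip w).rTensor M
        (TensorProduct.map₂ (LinearMap.mul k H) M.act.toLinearMap (comul (R := k) h) t) =
        (N.tensor M).act h ((N.act.toLinearMap.flip w).rTensor M t) := by
      induction t with
      | zero => simp
      | add x y hx hy => simp only [map_add, hx, hy]
      | tmul g m =>
        simp only [LinearMap.rTensor_tmul, tensorAct_tmul]
        induction comul (R := k) h with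
        | zero => simp
        | add x y hx hy => simp only [map_add, LinearMap.add_apply, hx, hy]
        | tmul p q => simp
    rw [tensorAct_tmul, h1, ← (M.axiomsAt v).compat, h2, braidingLin_tmul]

theorem braidingLin_coact (z : M ⊗[k] N) :
    (N.tensor M).coact (braidingLin M N z) =
      (braidingLin M N).lTensor H ((M.tensor N).coact z) := by
  induction z with
  | zero => simp
  | add x y hx hy => simp only [map_add, hx, hy]
  | tmul v w =>
    -- both sides are expressed through the twice iterated coaction of `v`
    let G : H ⊗[k] N →ₗ[k] M →ₗ[k] H ⊗[k] (N ⊗[k] M) :=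
      LinearMap.flip ((LinearMap.lTensorHom H) ∘ₗ (TensorProduct.mk k N M).flip)
    have hG (g : H) (n : N) (m : M) : G (g ⊗ₜ n) m = g ⊗ₜ (n ⊗ₜ m) := by simp [G]
    have h1 (t : H ⊗[k] M) : (N.tensor M).coact ((N.act.toLinearMap.flip w).rTensor M t) =
        TensorProduct.lift (G ∘ₗ TensorProduct.lift (mulRightFirst k H N ∘ₗ N.coact ∘ₗ
          N.act.toLinearMap.flip w)) ((TensorProduct.assoc k H H M).symm
            (M.coact.lTensor H t)) := by
      induction t with
      | zero => simp
      | add x y hx hy => simp only [map_add, hx, hy]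
      | tmul g m =>
        simp only [LinearMap.rTensor_tmul, tensorCoact_tmul, LinearMap.lTensor_tmul]
        induction M.coact m with
        | zero => simp
        | add x y hx hy => simp only [map_add, TensorProduct.tmul_add, hx, hy]
        | tmul p m =>
          simp only [TensorProduct.assoc_symm_tmul, TensorProduct.lift.tmul, LinearMap.comp_apply]
          induction N.coact (N.act.toLinearMap.flip w g) with
          | zero => simp
          | add x y hx hy => simp only [map_add, LinearMap.add_apply, hx, hy]
          | tmul q n => simp [hG]
    have h2 (t : H ⊗[k] M) : TensorProduct.lift (G ∘ₗ TensorProduct.lift (mulRightFirst k H N ∘ₗ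
        N.coact ∘ₗ N.act.toLinearMap.flip w)) ((comul (R := k) (A := H)).rTensor M t) =
        TensorProduct.lift (G ∘ₗ (TensorProduct.map₂ (LinearMap.mul k H) N.act.toLinearMap).flip
          (N.coact w)) ((comul (R := k) (A := H)).rTensor M t) := by
      induction t with
      | zero => simp
      | add x y hx hy => simp only [map_add, hx, hy]
      | tmul g m => simp [← (N.axiomsAt w).compat]
    have h3 (t : H ⊗[k] M) (s : H ⊗[k] N) :
        (braidingLin M N).lTensor H (mulFirst k H M N t s) =
        TensorProduct.lift (G ∘ₗ (TensorProduct.map₂ (LinearMap.mul k H) N.act.toLinearMap).flip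
          s) ((TensorProduct.assoc k H H M).symm (M.coact.lTensor H t)) := by
      induction t with
      | zero => simp
      | add x y hx hy => simp only [map_add, LinearMap.add_apply, hx, hy]
      | tmul g m =>
        induction s with
        | zero => simp [lift_zero_apply]
        | add x y hx hy => simp only [map_add, LinearMap.comp_add, lift_add_apply, hx, hy]
        | tmul q n =>
          simp only [mulFirst_tmul, LinearMap.lTensor_tmul, braidingLin_tmul]
          induction M.coact m with
          | zero => simp
          | add x y hx hy => simp only [map_add, TensorProduct.tmul_add, hx, hy]
          | tmul p m => simp [hG]
    rw [braidingLin_tmul, h1, ← (M.axiomsAt v).coassoc, LinearEquiv.symm_apply_apply, h2,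
      tensorCoact_tmul, h3, ← (M.axiomsAt v).coassoc, LinearEquiv.symm_apply_apply]

/-- The braiding `c : M ⊗ N → N ⊗ M`, `c(x ⊗ y) = x₍₋₁₎.y ⊗ x₍₀₎`, with inverse
`c⁻¹(x ⊗ y) = y₍₀₎ ⊗ S⁻¹(y₍₋₁₎).x`. -/
def braiding : YDIso (M.tensor N) (N.tensor M) where
  toEquiv := LinearEquiv.ofLinearMap (braidingLin M N) (braidingInvLin M N (antipodeInv hS))
    (LinearMap.ext (braidingLin_braidingInvLin M N hS))
    (LinearMap.ext (braidingInvLin_braidingLin M N hS))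
  map_act := braidingLin_act M N
  map_coact := braidingLin_coact M N

end

end Braiding

/-- The inverse of an isomorphism. -/
def YDIso.symmHom {M N : YDMod k H} (e : YDIso M N) : YDHom N M where
  toLin := e.toEquiv.symm.toLinearMap
  map_act h v := by
    apply e.toEquiv.injective
    simp [e.map_act]
  map_coact v := by
    obtain ⟨w, rfl⟩ := e.toEquiv.surjective v
    rw [e.map_coact, ← LinearMap.comp_apply (LinearMap.lTensor _ _), ← LinearMap.lTensor_comp]
    simp

section TensorAlgebra

variable (V : YDMod k H)

/-- The action of `H` on `TV`, as the algebra map from `TV` to the convolution algebra of linear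
maps `H → TV` that extends `v ↦ (h ↦ h.v)`; it satisfies `h.(x y) = (h₍₁₎.x) (h₍₂₎.y)`. -/
def tensorAlgebraActConv : TensorAlgebra k V →ₐ[k] WithConv (H →ₗ[k] TensorAlgebra k V) :=
  TensorAlgebra.lift k ((WithConv.linearEquiv k (H →ₗ[k] TensorAlgebra k V)).symm.toLinearMap ∘ₗ
    V.act.toLinearMap.flip.compr₂ (TensorAlgebra.ι k))

theorem tensorAlgebraActConv_ι (v : V) (h : H) :
    (tensorAlgebraActConv V (TensorAlgebra.ι k v)).ofConv h = TensorAlgebra.ι k (V.act h v) := by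
  simp [tensorAlgebraActConv]

theorem tensorAlgebraActConv_algebraMap (c : k) (h : H) :
    (tensorAlgebraActConv V (algebraMap k _ c)).ofConv h = (c * counit h) • 1 := by
  rw [AlgHom.commutes]
  simp [Algebra.algebraMap_eq_smul_one, smul_smul]

theorem tensorAlgebraActConv_mul (x y : TensorAlgebra k V) (h : H) :
    (tensorAlgebraActConv V (x * y)).ofConv h = LinearMap.mul' k _
      (TensorProduct.map (tensorAlgebraActConv V x).ofConv (tensorAlgebraActConv V y).ofConv
        (comul (R := k) h)) := by
  rw [map_mul, LinearMap.convMul_apply]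

/-- The action of `H` on `TV`. -/
def tensorAlgebraAct : H →ₐ[k] Module.End k (TensorAlgebra k V) :=
  AlgHom.ofLinearMap
    (LinearMap.flip ((WithConv.linearEquiv k (H →ₗ[k] TensorAlgebra k V)).toLinearMap ∘ₗ
      (tensorAlgebraActConv V).toLinearMap))
    (by
      ext x
      change (tensorAlgebraActConv V x).ofConv 1 = x
      induction x using TensorAlgebra.induction with
      | algebraMap r => simp [Algebra.algebraMap_eq_smul_one]
      | ι v => simp [tensorAlgebraActConv_ι]
      | mul x y hx hy =>
        rw [tensorAlgebraActConv_mul, Bialgebra.comul_one, Algebra.TensorProduct.one_def,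
          TensorProduct.map_tmul, hx, hy, LinearMap.mul'_apply]
      | add x y hx hy => simp [hx, hy])
    (by
      intro g h
      ext x
      change (tensorAlgebraActConv V x).ofConv (g * h) =
        (tensorAlgebraActConv V ((tensorAlgebraActConv V x).ofConv h)).ofConv g
      induction x using TensorAlgebra.induction generalizing g h with
      | algebraMap r =>
        rw [tensorAlgebraActConv_algebraMap, tensorAlgebraActConv_algebraMap,
          ← Algebra.algebraMap_eq_smul_one, ← Algebra.algebraMap_eq_smul_one,
          tensorAlgebraActConv_algebraMap]
        simp [Algebra.algebraMap_eq_smul_one, mul_assoc, mul_comm (counit (R := k) g)]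
      | ι v => simp [tensorAlgebraActConv_ι]
      | mul x y hx hy =>
        rw [tensorAlgebraActConv_mul, tensorAlgebraActConv_mul, Bialgebra.comul_mul]
        induction comul (R := k) h with
        | zero => simp
        | add s t hs ht => simp only [map_add, mul_add, WithConv.ofConv_add,
            LinearMap.add_apply, hs, ht]
        | tmul h₁ h₂ =>
          rw [TensorProduct.map_tmul, LinearMap.mul'_apply, tensorAlgebraActConv_mul]
          induction comul (R := k) g with
          | zero => simp
          | add s t hs ht => simp only [map_add, add_mul, hs, ht]
          | tmul g₁ g₂ => simp [hx, hy]
      | add x y hx hy => simp [hx, hy])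

theorem tensorAlgebraAct_apply (h : H) (x : TensorAlgebra k V) :
    tensorAlgebraAct V h x = (tensorAlgebraActConv V x).ofConv h := rfl

/-- The coaction of `H` on `TV`, the algebra map `TV → H ⊗ TV` that extends the coaction of `V`. -/
def tensorAlgebraCoact : TensorAlgebra k V →ₐ[k] H ⊗[k] TensorAlgebra k V :=
  TensorAlgebra.lift k ((TensorAlgebra.ι k).lTensor H ∘ₗ V.coact)

theorem tensorAlgebraCoact_ι (v : V) :
    tensorAlgebraCoact V (TensorAlgebra.ι k v) = (TensorAlgebra.ι k).lTensor H (V.coact v) := by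
  simp [tensorAlgebraCoact]

theorem lTensor_mul'_mulFirst {A : Type u} [Ring A] [Algebra k A] (t s : H ⊗[k] A) :
    (LinearMap.mul' k A).lTensor H (mulFirst k H A A t s) = t * s := by
  induction t with
  | zero => simp
  | add x y hx hy => simp only [map_add, LinearMap.add_apply, add_mul, hx, hy]
  | tmul g m =>
    induction s with
    | zero => simp
    | add x y hx hy => simp only [map_add, mul_add, hx, hy]
    | tmul g' n => simp

theorem tensorAlgebra_mul'_act (h : H) (z : TensorAlgebra k V ⊗[k] TensorAlgebra k V) :
    LinearMap.mul' k _ (tensorAct (tensorAlgebraAct V) (tensorAlgebraAct V) h z) =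
      tensorAlgebraAct V h (LinearMap.mul' k _ z) := by
  induction z with
  | zero => simp
  | add x y hx hy => simp only [map_add, hx, hy]
  | tmul x y =>
    rw [tensorAct_tmul, LinearMap.mul'_apply, tensorAlgebraAct_apply, tensorAlgebraActConv_mul]
    rfl

theorem tensorAlgebra_mul'_coact (z : TensorAlgebra k V ⊗[k] TensorAlgebra k V) :
    tensorAlgebraCoact V (LinearMap.mul' k _ z) = (LinearMap.mul' k _).lTensor H
      (tensorCoact (tensorAlgebraCoact V).toLinearMap (tensorAlgebraCoact V).toLinearMap z) := by
  induction z with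
  | zero => simp
  | add x y hx hy => simp only [map_add, hx, hy]
  | tmul x y => simp [lTensor_mul'_mulFirst]

theorem tensorAlgebra_one_act (h : H) (c : k) :
    Algebra.linearMap k (TensorAlgebra k V) ((YDMod.unit k H).act h c) =
      tensorAlgebraAct V h (Algebra.linearMap k _ c) := by
  rw [tensorAlgebraAct_apply, Algebra.linearMap_apply, Algebra.linearMap_apply,
    tensorAlgebraActConv_algebraMap]
  simp [Algebra.ofId_apply, Algebra.algebraMap_eq_smul_one, mul_comm]

theorem tensorAlgebra_one_coact (c : k) :
    tensorAlgebraCoact V (Algebra.linearMap k _ c) =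
      (Algebra.linearMap k _).lTensor H ((YDMod.unit k H).coact c) := by
  simp [Algebra.algebraMap_eq_smul_one, Algebra.TensorProduct.one_def]

/-- The tensor algebra `TV` as a Yetter-Drinfeld module. -/
abbrev YDMod.tensorAlgebra : YDMod k H where
  carrier := TensorAlgebra k V
  act := tensorAlgebraAct V
  coact := (tensorAlgebraCoact V).toLinearMap
  axiomsAt x := by
    induction x using TensorAlgebra.induction with
    | algebraMap r =>
      exact AxiomsAt.map (tensorAlgebra_one_act V) (tensorAlgebra_one_coact V)
        ((YDMod.unit k H).axiomsAt r)
    | ι v =>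
      exact AxiomsAt.map (f := TensorAlgebra.ι k)
        (fun h v => (tensorAlgebraActConv_ι V v h).symm)
        (tensorAlgebraCoact_ι V) (V.axiomsAt v)
    | mul x y hx hy =>
      have := AxiomsAt.map (ε := (tensorAlgebraCoact V).toLinearMap)
        (tensorAlgebra_mul'_act V) (tensorAlgebra_mul'_coact V) (hx.tmul hy)
      rwa [LinearMap.mul'_apply] at this
    | add x y hx hy => exact hx.add hy

namespace YDHom

/-- The inclusion `V → TV`. -/
def ι : YDHom V V.tensorAlgebra where
  toLin := TensorAlgebra.ι k
  map_act h v := (tensorAlgebraActConv_ι V v h).symm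
  map_coact := tensorAlgebraCoact_ι V

/-- The unit `k → TV`. -/
def one : YDHom (YDMod.unit k H) V.tensorAlgebra where
  toLin := Algebra.linearMap k _
  map_act := tensorAlgebra_one_act V
  map_coact := tensorAlgebra_one_coact V

/-- The multiplication `TV ⊗ TV → TV`. -/
def mul : YDHom (V.tensorAlgebra.tensor V.tensorAlgebra) V.tensorAlgebra where
  toLin := LinearMap.mul' k _
  map_act := tensorAlgebra_mul'_act V
  map_coact := tensorAlgebra_mul'_coact V

variable {V} in
/-- The algebra map `TW → TV` that extends a morphism `W → TV`. -/
def lift {W : YDMod k H} (f : YDHom W V.tensorAlgebra) :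
    YDHom W.tensorAlgebra V.tensorAlgebra where
  toLin := (TensorAlgebra.lift k f.toLin).toLinearMap
  map_act h x := by
    rw [tensorAlgebraAct_apply, tensorAlgebraAct_apply, AlgHom.toLinearMap_apply,
      AlgHom.toLinearMap_apply]
    induction x using TensorAlgebra.induction generalizing h with
    | algebraMap r =>
      rw [tensorAlgebraActConv_algebraMap, AlgHom.commutes, tensorAlgebraActConv_algebraMap]
      simp
    | ι w =>
      rw [tensorAlgebraActConv_ι, TensorAlgebra.lift_ι_apply, TensorAlgebra.lift_ι_apply,
        f.map_act]
      rfl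
    | mul x y hx hy =>
      rw [tensorAlgebraActConv_mul, map_mul (TensorAlgebra.lift k f.toLin),
        tensorAlgebraActConv_mul]
      induction comul (R := k) h with
      | zero => simp
      | add s t hs ht => simp only [map_add, hs, ht]
      | tmul h₁ h₂ => simp [hx, hy]
    | add x y hx hy => simp [hx, hy]
  map_coact x := by
    have : (tensorAlgebraCoact V).comp (TensorAlgebra.lift k f.toLin) =
        (Algebra.TensorProduct.map (AlgHom.id k H) (TensorAlgebra.lift k f.toLin)).comp
          (tensorAlgebraCoact W) := by
      ext w
      have h1 := f.map_coact w
      have h2 (t : H ⊗[k] W) : Algebra.TensorProduct.map (AlgHom.id k H)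
          (TensorAlgebra.lift k f.toLin) ((TensorAlgebra.ι k).lTensor H t) =
          f.toLin.lTensor H t := by
        induction t with
        | zero => simp
        | add x y hx hy => simp only [map_add, hx, hy]
        | tmul h w => simp
      change tensorAlgebraCoact V (TensorAlgebra.lift k f.toLin (TensorAlgebra.ι k w)) =
        Algebra.TensorProduct.map (AlgHom.id k H) (TensorAlgebra.lift k f.toLin)
          (tensorAlgebraCoact W (TensorAlgebra.ι k w))
      rw [tensorAlgebraCoact_ι, h2, TensorAlgebra.lift_ι_apply]
      exact h1
    exact DFunLike.congr_fun this x

variable (hS : Function.Bijective (HopfAlgebra.antipode k (A := H)))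

/-- The bracket `[x, y] = x y - m c⁻¹(x ⊗ y)` on `TV`. -/
def bracket : YDHom (V.tensorAlgebra.tensor V.tensorAlgebra) V.tensorAlgebra :=
  (mul V).sub ((mul V).comp (braiding V.tensorAlgebra V.tensorAlgebra hS).symmHom)

end YDHom

/-- The submodule `⨁_{n ≥ 1} V^{⊗ n}` of `TV`. -/
def tensorPlusSubmodule (W : Type u) [AddCommGroup W] [Module k W] :
    Submodule k (TensorAlgebra k W) :=
  ⨆ n : ℕ, LinearMap.range (TensorAlgebra.ι k (M := W)) ^ (n + 1)

theorem range_lTensor_mono {M : Type u} [AddCommGroup M] [Module k M] {N P : Submodule k M}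
    (h : N ≤ P) :
    LinearMap.range (N.subtype.lTensor H) ≤ LinearMap.range (P.subtype.lTensor H) := by
  have : N.subtype = P.subtype ∘ₗ Submodule.inclusion h := rfl
  rw [this, LinearMap.lTensor_comp]
  exact LinearMap.range_comp_le_range _ _

variable {V} in
theorem YDMod.IsSub.mul {N P : Submodule k (TensorAlgebra k V)} (hN : V.tensorAlgebra.IsSub N)
    (hP : V.tensorAlgebra.IsSub P) : V.tensorAlgebra.IsSub (N * P) where
  act_mem h x hx := by
    induction hx using Submodule.mul_induction_on' with
    | mem_mul_mem x hx y hy =>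
      rw [tensorAlgebraAct_apply, tensorAlgebraActConv_mul]
      induction comul (R := k) h with
      | zero => simp
      | add s t hs ht => simpa only [map_add] using add_mem hs ht
      | tmul h₁ h₂ => exact Submodule.mul_mem_mul (hN.act_mem h₁ x hx) (hP.act_mem h₂ y hy)
    | add x _ y _ hx hy => simpa only [map_add] using add_mem hx hy
  coact_mem x hx := by
    induction hx using Submodule.mul_induction_on' with
    | mem_mul_mem x hx y hy =>
      obtain ⟨t, ht⟩ := hN.coact_mem x hx
      obtain ⟨s, hs⟩ := hP.coact_mem y hy
      rw [AlgHom.toLinearMap_apply] at ht hs ⊢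
      rw [map_mul, ← ht, ← hs]
      clear ht hs
      induction t with
      | zero => simp
      | add x y hx hy => simpa only [map_add, add_mul] using add_mem hx hy
      | tmul g m =>
        induction s with
        | zero => simp
        | add x y hx hy => simpa only [map_add, mul_add] using add_mem hx hy
        | tmul g' n =>
          exact ⟨(g * g') ⊗ₜ ⟨m * n, Submodule.mul_mem_mul m.2 n.2⟩, by simp⟩
    | add x _ y _ hx hy => simpa only [map_add] using add_mem hx hy

theorem YDMod.IsSub.iSup {M : YDMod k H} {ι : Type} {N : ι → Submodule k M}
    (hN : ∀ i, M.IsSub (N i)) : M.IsSub (⨆ i, N i) where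
  act_mem h := by
    have : ⨆ i, N i ≤ (⨆ i, N i).comap (M.act h) :=
      iSup_le fun i x hx => le_iSup N i ((hN i).act_mem h x hx)
    exact this
  coact_mem := by
    have : ⨆ i, N i ≤ (LinearMap.range ((⨆ i, N i).subtype.lTensor H)).comap M.coact :=
      iSup_le fun i x hx => range_lTensor_mono (le_iSup N i) ((hN i).coact_mem x hx)
    exact this

theorem isSub_tensorPlusSubmodule : V.tensorAlgebra.IsSub (tensorPlusSubmodule V) := by
  refine YDMod.IsSub.iSup fun n => ?_
  induction n with
  | zero =>
    rw [zero_add, pow_one]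
    exact (YDHom.ι V).isSub_range
  | succ n ih =>
    rw [pow_succ]
    exact ih.mul (YDHom.ι V).isSub_range

/-- `T⁺V = ⨁_{n ≥ 1} V^{⊗ n}` as a Yetter-Drinfeld module. -/
abbrev YDMod.tensorPlus : YDMod k H :=
  V.tensorAlgebra.sub (tensorPlusSubmodule V) (isSub_tensorPlusSubmodule V)

end TensorAlgebra

section Words

/-- A word is a Lyndon word if it is nonempty and lexicographically smaller than each of its proper
nonempty right factors. -/
def IsLyndon {d : ℕ} (u : List (Fin d)) : Prop :=
  u ≠ [] ∧ ∀ u₁ u₂ : List (Fin d), u₁ ≠ [] → u₂ ≠ [] → u = u₁ ++ u₂ → u < u₂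

/-- The set of Lyndon words in the letters `Fin d`, with the lexicographic order. -/
abbrev LyndonWord (d : ℕ) : Type := {u : List (Fin d) // IsLyndon u}

theorem isLyndon_singleton {d : ℕ} (a : Fin d) : IsLyndon [a] := by
  refine ⟨by simp, fun u₁ u₂ h₁ h₂ h => ?_⟩
  rcases u₁ with - | ⟨b, u₁⟩
  · exact absurd rfl h₁
  · simp_all

/-- The length of `v` in the Shirshov decomposition `(v, w)` of a word `u = v w` of length at least
two, for which `w` is the longest proper right factor of `u` that is a Lyndon word. -/
def shirshovIndex {d : ℕ} (u : List (Fin d)) : ℕ := sInf {n | 0 < n ∧ IsLyndon (u.drop n)}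

theorem shirshovIndex_spec {d : ℕ} {u : List (Fin d)} (hu : ¬ u.length ≤ 1) :
    0 < shirshovIndex u ∧ shirshovIndex u < u.length := by
  have h : u.length - 1 ∈ {n | 0 < n ∧ IsLyndon (u.drop n)} := by
    refine ⟨by omega, ?_⟩
    have hu' : u ≠ [] := by rintro rfl; simp at hu
    rw [List.drop_length_sub_one hu']
    exact isLyndon_singleton _
  refine ⟨(Nat.sInf_mem ⟨_, h⟩).1, lt_of_le_of_lt (Nat.sInf_le h) (by omega)⟩

section ListTensor

variable {ι : Type}

/-- The tensor product `W_{i₁} ⊗ ⋯ ⊗ W_{iᵣ}` along a list `[i₁, …, iᵣ]`. -/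
def YDMod.listTensor (W : ι → YDMod k H) : List ι → YDMod k H
  | [] => YDMod.unit k H
  | i :: l => (W i).tensor (YDMod.listTensor W l)

/-- The multiplication map `x₁ ⊗ ⋯ ⊗ xᵣ ↦ f(x₁) ⋯ f(xᵣ)` from a tensor product along a list to a
tensor algebra. -/
def YDHom.listMul {W : ι → YDMod k H} {V : YDMod k H} (f : ∀ i, YDHom (W i) V.tensorAlgebra) :
    ∀ l : List ι, YDHom (YDMod.listTensor W l) V.tensorAlgebra
  | [] => YDHom.one V
  | i :: l => (YDHom.mul V).comp ((f i).tensor (YDHom.listMul f l))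

/-- The canonical isomorphism from the tensor product along a list `l` to the tensor product of the
one along the first `n` entries of `l` and the one along the remaining entries. -/
def YDHom.listSplit (W : ι → YDMod k H) : ∀ (n : ℕ) (l : List ι),
    YDHom (YDMod.listTensor W l)
      ((YDMod.listTensor W (l.take n)).tensor (YDMod.listTensor W (l.drop n)))
  | 0, l => YDHom.leftUnitorInv (YDMod.listTensor W l)
  | _ + 1, [] => YDHom.leftUnitorInv (YDMod.listTensor W [])
  | n + 1, i :: l =>
    (YDHom.assocInv (W i) (YDMod.listTensor W (l.take n)) (YDMod.listTensor W (l.drop n))).comp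
      ((YDHom.id (W i)).tensor (YDHom.listSplit W n l))

/-- The ordered product of the `W i`: the direct sum of the tensor products
`W_{i₁} ⊗ ⋯ ⊗ W_{iᵣ}` over all `r ≥ 1` and `i₁ > ⋯ > iᵣ`. -/
abbrev YDMod.ordProd [LinearOrder ι] (W : ι → YDMod k H) : YDMod k H :=
  YDMod.directSum fun l : {l : List ι // l ≠ [] ∧ l.Pairwise (· > ·)} => YDMod.listTensor W l.1

end ListTensor

variable (hS : Function.Bijective (HopfAlgebra.antipode k (A := H)))
  {d : ℕ} (V : Fin d → YDMod k H)

/-- The inclusion of `V_i` into `TV`, for `V` the direct sum of the `V_i`. -/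
def YDHom.letter (i : Fin d) : YDHom (V i) (YDMod.directSum V).tensorAlgebra :=
  (YDHom.ι (YDMod.directSum V)).comp
    { toLin := DirectSum.lof k (Fin d) (fun i => (V i).carrier) i
      map_act := fun h v => by simp
      map_coact := fun v => by simp }

/-- The bracket operation `x ↦ [x]` on the space `V^u = V_{a₁} ⊗ ⋯ ⊗ V_{aᵣ}` of `u`-vectors, with
values in `TV`: `[x_u] = x_u` if `u` has length at most one, and `[x_u] = [[x_v], [x_w]]` if `u` is
longer and `(v, w)` is its Shirshov decomposition. It is used for Lyndon words `u` only. -/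
def wordBracket (u : List (Fin d)) :
    YDHom (YDMod.listTensor V u) (YDMod.directSum V).tensorAlgebra :=
  if u.length ≤ 1 then YDHom.listMul (YDHom.letter V) u
  else
    (YDHom.bracket (YDMod.directSum V) hS).comp
      (((wordBracket (u.take (shirshovIndex u))).tensor
        (wordBracket (u.drop (shirshovIndex u)))).comp
          (YDHom.listSplit V (shirshovIndex u) u))
termination_by u.length
decreasing_by
  all_goals
    rename_i hu
    have := shirshovIndex_spec hu
    simp
    omega

/-- The space `V^{[u]} = [V^u]` of bracketed `u`-letters, a Yetter-Drinfeld submodule of `TV`. -/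
abbrev lyndonSpace (u : LyndonWord d) : YDMod k H := (wordBracket hS V u.1).range

/-- The algebra map `TV^{[u]} → TV` that extends the inclusion of `V^{[u]}` in `TV`. -/
def lyndonLift (u : LyndonWord d) :
    YDHom (lyndonSpace hS V u).tensorAlgebra (YDMod.directSum V).tensorAlgebra :=
  YDHom.lift (YDHom.subtype (wordBracket hS V u.1).isSub_range)

/-- The multiplication map `μ` from the ordered product of the `T⁺V^{[u]}` to `TV`, which sends
`x₁ ⊗ ⋯ ⊗ xᵣ` in `T⁺V^{[u₁]} ⊗ ⋯ ⊗ T⁺V^{[uᵣ]}` to the product `x₁ ⋯ xᵣ` in `TV`. -/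
def multiplicationMap :
    (YDMod.ordProd fun u : LyndonWord d => (lyndonSpace hS V u).tensorPlus) →ₗ[k]
      TensorAlgebra k (YDMod.directSum V) :=
  DirectSum.toModule k _ _ fun l =>
    (YDHom.listMul (fun u : LyndonWord d => (lyndonLift hS V u).comp
      (YDHom.subtype (isSub_tensorPlusSubmodule (lyndonSpace hS V u)))) l.1).toLin

/-- The Hilbert series `∑ dim(𝒜 n) tⁿ` of a graded vector space with finite-dimensional
homogeneous components. -/
def hilbertSeries {A : Type u} [AddCommGroup A] [Module k A] (𝒜 : ℕ → Submodule k A) :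
    PowerSeries ℤ :=
  PowerSeries.mk fun n => (Module.finrank k (𝒜 n) : ℤ)

/-- The grading of `TW`, with `W` in degree one. -/
def tensorGrading (W : Type u) [AddCommGroup W] [Module k W] (n : ℕ) :
    Submodule k (TensorAlgebra k W) :=
  LinearMap.range (TensorAlgebra.ι k (M := W)) ^ n

/-- The algebra `TV^{[u]}`, as a subalgebra of `TV`. -/
def lyndonSubalgebra (u : LyndonWord d) : Subalgebra k (TensorAlgebra k (YDMod.directSum V)) :=
  (TensorAlgebra.lift k (LinearMap.range (wordBracket hS V u.1).toLin).subtype).range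

/-- The grading of the subalgebra `TV^{[u]}` of `TV` induced by the grading of `TV`. -/
def lyndonGrading (u : LyndonWord d) (n : ℕ) : Submodule k (lyndonSubalgebra hS V u) :=
  (tensorGrading (YDMod.directSum V) n).comap (lyndonSubalgebra hS V u).val.toLinearMap

end Words

end YetterDrinfeld

end

open YetterDrinfeld

universe w

namespace YetterDrinfeld

/-! ### Lyndon words and the Shirshov decomposition -/

section LyndonFactorization

variable {α : Type*} [LinearOrder α]

/-! The proof is a triangularity argument. Choose bases of the `V_i`; the words in the basis vectors
then form a basis of `TV`. Such a word has a colour, the word in the letters `1, …, d` that records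
from which `V_i` each of its entries comes. Words are compared by their colours alone, so different
basis words can be tied, and each tie class may be infinite.

The central fact is `wordBracket_hasLeadingTerm`: for a Lyndon word `u`, the bracket `[x]` of `x` in
`V^u` is `x` plus terms in spaces `V^{u'}` with `u'` larger than `u` and of the same length. Indeed,
if `u = vw` is the Shirshov decomposition, then `[x_v][x_w]` has the leading term `x_v x_w` by
induction. The other summand of the bracket exchanges the two factors and so involves only words
`w'v'` with `w' ≥ w`; since `u` is Lyndon, `u < w ≤ w' ≤ w'v'`. All that matters about the inverse
braiding is that it carries `N ⊗ P` into `P ⊗ N` for Yetter–Drinfeld submodules `N` and `P`.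

Leading terms are multiplicative. Every coloured word is in a unique way a concatenation of words
whose colours form a nonincreasing sequence of Lyndon words (`exists_lyndonFactorization`,
`lyndonFactorization_unique`). Hence the products `[x₁]⋯[xᵣ]` over all such sequences are related to
the word basis by a unitriangular system, and they form a homogeneous basis of `TV` (`pbwBasis`).
Independence needs no finiteness. For spanning, it suffices that there are finitely many colours of
each length, even if the `V_i` are infinite-dimensional.

Collecting equal colours in a nonincreasing sequence into blocks gives a strictly decreasing list
`u₁ > ⋯ > uᵣ` with a nonempty sequence of words for each entry. The corresponding pure tensors span
the source of `μ`, and `μ` sends them bijectively onto the basis elements with `r ≥ 1`. A spanning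
family with independent image forces injectivity, so it need not be known beforehand that `TV^{[u]}
→ TV` is injective or that the spanning family is a basis. The range is `T⁺V`, and `μ` is linear and
colinear because it is built from such maps.

For the Hilbert series, both `TV` in degree `n` and the subalgebra `TV^{[u]}` are spanned by subsets
of this one basis. Dimensions thus count Lyndon factorizations of total length `n`, and splitting
off the factors of the largest colour turns the count into a product of series. -/

theorem list_append_lt_append_of_not_prefix {u v : List α} (h : u < v) (hp : ¬ u <+: v)
    (a b : List α) : u ++ a < v ++ b := by
  induction u generalizing v with
  | nil => exact absurd List.nil_prefix hp
  | cons x u ih =>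
    cases v with
    | nil => simp at h
    | cons y v =>
      rw [List.cons_append, List.cons_append, List.cons_lt_cons_iff]
      rw [List.cons_lt_cons_iff] at h
      rcases h with h | ⟨rfl, h⟩
      · exact Or.inl h
      · exact Or.inr ⟨rfl, ih h fun hp' => hp (by simpa using hp')⟩

theorem list_append_lt_append_of_length_eq {u v : List α} (h : u < v)
    (hl : v.length = u.length) (a b : List α) : u ++ a < v ++ b :=
  list_append_lt_append_of_not_prefix h
    (fun hp => h.ne (hp.eq_of_length hl.symm)) a b

theorem list_lt_append_of_ne_nil (u : List α) {v : List α} (hv : v ≠ []) : u < u ++ v := by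
  induction u with
  | nil => cases v with
    | nil => exact absurd rfl hv
    | cons x v => simp
  | cons x u ih => simpa [List.cons_lt_cons_iff] using ih

theorem list_le_of_prefix {u v : List α} (h : u <+: v) : u ≤ v := by
  obtain ⟨w, rfl⟩ := h
  rcases eq_or_ne w [] with rfl | hw
  · simp
  · exact (list_lt_append_of_ne_nil u hw).le

variable {d : ℕ}

/-- The main point is `uv < v`. If `v = uz`, then `v < z` because `v` is Lyndon, and `u` can be put
in front of both sides; otherwise `u` and `v` already differ at some letter. A right factor inside
`v` is then at least `v`. A right factor `bv` with `b` a proper right factor of `u` is larger than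
`uv`, since `u < b` and `u` is too long to be a prefix of `b`. -/
theorem IsLyndon.append {u v : List (Fin d)} (hu : IsLyndon u) (hv : IsLyndon v) (h : u < v) :
    IsLyndon (u ++ v) := by
  have huv : u ++ v < v := by
    by_cases hp : u <+: v
    · obtain ⟨z, rfl⟩ := hp
      have hz : z ≠ [] := by rintro rfl; simp at h
      exact List.append_left_lt (hv.2 u z hu.1 hz rfl)
    · simpa using list_append_lt_append_of_not_prefix h hp v []
  refine ⟨by simp [hu.1], fun s t hs ht hst => ?_⟩
  rcases List.append_eq_append_iff.1 hst with ⟨a, rfl, rfl⟩ | ⟨b, rfl, rfl⟩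
  · rcases eq_or_ne a [] with rfl | ha
    · simpa using huv
    · exact huv.trans (hv.2 a t ha ht rfl)
  · rcases eq_or_ne b [] with rfl | hb
    · simpa using huv
    · have hlt := hu.2 s b hs hb rfl
      refine list_append_lt_append_of_not_prefix hlt (fun hp => ?_) _ _
      have h1 := hp.length_le
      have h2 := List.length_pos_of_ne_nil hs
      simp only [List.length_append] at h1
      omega

theorem shirshov_right {u : List (Fin d)} (hu : ¬ u.length ≤ 1) :
    IsLyndon (u.drop (shirshovIndex u)) := by
  have h : u.length - 1 ∈ {n | 0 < n ∧ IsLyndon (u.drop n)} := by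
    refine ⟨by omega, ?_⟩
    have hu' : u ≠ [] := by rintro rfl; simp at hu
    rw [List.drop_length_sub_one hu']
    exact isLyndon_singleton _
  exact (Nat.sInf_mem ⟨_, h⟩).2

/-- The longest Lyndon proper right factor of a word is its smallest proper right factor. -/
theorem shirshov_right_le {u : List (Fin d)} (hu : ¬ u.length ≤ 1) {n : ℕ} (hn : 0 < n)
    (hn' : n < u.length) : u.drop (shirshovIndex u) ≤ u.drop n := by
  obtain ⟨m, hm, hmin⟩ := Finset.exists_min_image (Finset.Ioo 0 u.length) (fun m => u.drop m)
    ⟨n, by simp [hn, hn']⟩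
  rw [Finset.mem_Ioo] at hm
  refine le_trans ?_ (hmin n (by simp [hn, hn']))
  -- The smallest proper right factor is Lyndon, because its own right factors are again proper
  -- right factors of `u`.
  have hL : IsLyndon (u.drop m) := by
    refine ⟨fun h => by simp at h; omega, fun s t hs ht hst => ?_⟩
    have hs' := List.length_pos_of_ne_nil hs
    have ht' := List.length_pos_of_ne_nil ht
    have hlen := congrArg List.length hst
    simp only [List.length_drop, List.length_append] at hlen
    have htd : t = u.drop (m + s.length) := by
      rw [← List.drop_drop, hst, List.drop_left]
    have := hmin (m + s.length) (by simp; omega)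
    rw [← htd] at this
    refine lt_of_le_of_ne this fun h => ?_
    have := congrArg List.length (hst.symm.trans h)
    simp only [List.length_append] at this
    omega
  have hle : shirshovIndex u ≤ m := Nat.sInf_le ⟨hm.1, hL⟩
  have hspec := shirshovIndex_spec hu
  rcases hle.eq_or_lt with h | h
  · rw [h]
  -- If the longest Lyndon right factor were strictly longer than the smallest one, it would have
  -- the latter as a proper right factor and so would be smaller than it.
  · have hd : u.drop (shirshovIndex u) =
        (u.drop (shirshovIndex u)).take (m - shirshovIndex u) ++ u.drop m := by
      have := (List.take_append_drop (m - shirshovIndex u) (u.drop (shirshovIndex u))).symm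
      rwa [List.drop_drop, Nat.add_sub_cancel' hle] at this
    refine ((shirshov_right hu).2 _ _ ?_ hL.1 hd).le
    intro h0
    have := congrArg List.length h0
    simp only [List.length_take, List.length_drop, List.length_nil] at this
    omega

/-- Let `u = stw` with `w` the Shirshov right factor, and suppose that `t < st`. As `u` is Lyndon,
`stw < tw`. If `st = tz`, cancelling `t` gives `zw < w`, against the minimality of `w` among the
proper right factors of `u`. If `t` is not a prefix of `st`, then `t < st` already gives `tw < stw`.
-/
theorem IsLyndon.shirshov_left {u : List (Fin d)} (hL : IsLyndon u) (hu : ¬ u.length ≤ 1) :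
    IsLyndon (u.take (shirshovIndex u)) := by
  have hspec := shirshovIndex_spec hu
  have hmin := fun n => shirshov_right_le hu (n := n)
  have huw := (List.take_append_drop (shirshovIndex u) u)
  set w := u.drop (shirshovIndex u) with hw
  refine ⟨fun h => ?_, fun s t hs ht hst => ?_⟩
  · have := congrArg List.length h
    simp only [List.length_take, List.length_nil] at this
    omega
  have hs' := List.length_pos_of_ne_nil hs
  have ht' := List.length_pos_of_ne_nil ht
  have hlen := congrArg List.length hst
  simp only [List.length_take, List.length_append] at hlen
  rw [hst] at huw ⊢
  by_contra hcon
  have hts : t < s ++ t := by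
    refine lt_of_le_of_ne (not_lt.1 hcon) fun h => ?_
    have := congrArg List.length h
    simp only [List.length_append] at this
    omega
  have hut : s ++ t ++ w < t ++ w := by
    have h1 : u < t ++ w := hL.2 s (t ++ w) hs (by simp [ht]) (by rw [← huw]; simp)
    rwa [← huw] at h1
  by_cases hp : t <+: s ++ t
  · obtain ⟨z, hz⟩ := hp
    rw [← hz, List.append_assoc] at hut
    have hzw : z ++ w < w := by
      by_contra h
      rcases (not_lt.1 h).eq_or_lt with h | h
      · rw [← h] at hut; exact lt_irrefl _ hut
      · exact lt_asymm hut (List.append_left_lt h)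
    have hd : u.drop t.length = z ++ w := by
      rw [← huw, ← hz, List.append_assoc, List.drop_left]
    have := hmin t.length ht' (by omega)
    rw [hd] at this
    exact absurd hzw (not_lt.2 this)
  · exact lt_asymm hut (list_append_lt_append_of_not_prefix hts hp w w)

theorem IsLyndon.lt_shirshov_right {u : List (Fin d)} (hL : IsLyndon u) (hu : ¬ u.length ≤ 1) :
    u < u.drop (shirshovIndex u) := by
  have hspec := shirshovIndex_spec hu
  refine hL.2 (u.take (shirshovIndex u)) _ ?_ ?_ (List.take_append_drop _ u).symm <;>
  · intro h
    have := congrArg List.length h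
    simp only [List.length_take, List.length_drop, List.length_nil] at this
    omega

/-! ### Unique Lyndon factorization of coloured words -/

variable {X : Type*} (c : X → Fin d)

/-- The sequences of coloured words whose colours form a nonincreasing sequence of Lyndon words. -/
def lyndonFactorizations : Set (List (List X)) :=
  {W | (∀ x ∈ W, IsLyndon (x.map c)) ∧ W.Pairwise fun x y => y.map c ≤ x.map c}

variable {c}

/-- If the colour of `x` is at least that of the first factor `w`, then `x` can be put in front.
Otherwise `xw` again has a Lyndon colour, and the same argument applies to `xw` and the remaining
factors. -/
theorem exists_lyndonFactorization_cons {W : List (List X)} (hW : W ∈ lyndonFactorizations c)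
    {x : List X} (hx : IsLyndon (x.map c)) :
    ∃ W' ∈ lyndonFactorizations c, W'.flatten = x ++ W.flatten := by
  induction W generalizing x with
  | nil => exact ⟨[x], by simp [lyndonFactorizations, hx], by simp⟩
  | cons w W ih =>
    have hW1 := hW.1
    have hW2 := List.pairwise_cons.1 hW.2
    by_cases h : w.map c ≤ x.map c
    · refine ⟨x :: w :: W, ⟨?_, ?_⟩, by simp⟩
      · intro y hy
        rcases List.mem_cons.1 hy with rfl | hy
        · exact hx
        · exact hW1 y hy
      · refine List.pairwise_cons.2 ⟨fun y hy => ?_, hW.2⟩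
        rcases List.mem_cons.1 hy with rfl | hy
        · exact h
        · exact (hW2.1 y hy).trans h
    · obtain ⟨W', hW', hf⟩ := ih ⟨fun y hy => hW1 y (by simp [hy]), hW2.2⟩ (x := x ++ w)
        (by rw [List.map_append]; exact hx.append (hW1 w (by simp)) (not_le.1 h))
      exact ⟨W', hW', by simp [hf]⟩

theorem exists_lyndonFactorization (x : List X) :
    ∃ W ∈ lyndonFactorizations c, W.flatten = x := by
  induction x with
  | nil => exact ⟨[], by simp [lyndonFactorizations], rfl⟩
  | cons a x ih =>
    obtain ⟨W, hW, rfl⟩ := ih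
    exact exists_lyndonFactorization_cons hW (x := [a]) (isLyndon_singleton _)

/-- Cut `z` at the beginning of the last factor that it reaches. What remains is a nonempty prefix
of that factor, hence at most that factor, hence at most `κ`. -/
theorem exists_suffix_le_of_prefix_flatten {κ : List (Fin d)} {W : List (List X)}
    (hW : ∀ x ∈ W, x.map c ≤ κ) {z : List X} (hz : z ≠ []) (hp : z <+: W.flatten) :
    ∃ p, p ≠ [] ∧ p <:+ z ∧ p.map c ≤ κ := by
  induction W generalizing z with
  | nil => exact absurd (by simpa using hp) hz
  | cons w W ih =>
    rw [List.flatten_cons] at hp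
    obtain ⟨t, ht⟩ := hp
    rcases List.append_eq_append_iff.1 ht with ⟨a, rfl, ha⟩ | ⟨b, rfl, hb⟩
    · refine ⟨z, hz, List.suffix_refl _, le_trans (list_le_of_prefix ?_) (hW (z ++ a) (by simp))⟩
      rw [List.map_append]
      exact List.prefix_append _ _
    · rcases eq_or_ne b [] with rfl | hb0
      · exact ⟨w ++ [], hz, List.suffix_refl _, by simpa using hW w (by simp)⟩
      · obtain ⟨p, hp0, hp, hpκ⟩ := ih (fun x hx => hW x (by simp [hx])) hb0 ⟨t, hb.symm⟩
        exact ⟨p, hp0, hp.trans (List.suffix_append _ _), hpκ⟩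

/-- This compares the first factors `x` and `xz` of two factorizations of one word. If `z` were
nonempty, it would have a nonempty suffix `p` with colour at most that of `x`, so at most that of
`xz`. But `p` is a proper right factor of `xz`, whose colour is Lyndon. -/
theorem not_cons_lyndonFactorization {x z : List X} {W W' : List (List X)}
    (hx : x :: W ∈ lyndonFactorizations c) (hy : (x ++ z) :: W' ∈ lyndonFactorizations c)
    (h : W.flatten = z ++ W'.flatten) : z = [] := by
  by_contra hz
  obtain ⟨p, hp, ⟨q, rfl⟩, hpx⟩ := exists_suffix_le_of_prefix_flatten
    (List.pairwise_cons.1 hx.2).1 hz ⟨_, h.symm⟩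
  have hx0 : x ≠ [] := fun h0 => (hx.1 x (by simp)).1 (by simp [h0])
  have h1 := (hy.1 (x ++ (q ++ p)) (by simp)).2 ((x ++ q).map c) (p.map c) (by simp [hx0])
    (by simp [hp]) (by simp)
  have h2 : x.map c ≤ (x ++ (q ++ p)).map c :=
    list_le_of_prefix (by rw [List.map_append]; exact List.prefix_append _ _)
  exact absurd (h1.trans_le (hpx.trans h2)) (lt_irrefl _)

theorem lyndonFactorization_unique {W W' : List (List X)} (hW : W ∈ lyndonFactorizations c)
    (hW' : W' ∈ lyndonFactorizations c) (h : W.flatten = W'.flatten) : W = W' := by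
  have key (y : List X) (Y : List (List X)) (hY : y :: Y ∈ lyndonFactorizations c) :
      (y :: Y).flatten ≠ [] := by
    intro h0
    have : y = [] := by simp at h0; exact h0.1
    exact (hY.1 y (by simp)).1 (by simp [this])
  induction W generalizing W' with
  | nil =>
    cases W' with
    | nil => rfl
    | cons y W' => exact absurd h.symm (key y W' hW')
  | cons x W ih =>
    cases W' with
    | nil => exact absurd h (key x W hW)
    | cons y W' =>
      have hxy : x = y := by
        rw [List.flatten_cons, List.flatten_cons] at h
        rcases List.append_eq_append_iff.1 h with ⟨a, rfl, ha⟩ | ⟨b, rfl, hb⟩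
        · rw [not_cons_lyndonFactorization hW hW' ha, List.append_nil]
        · rw [not_cons_lyndonFactorization hW' hW hb, List.append_nil]
      subst hxy
      congr 1
      refine ih ⟨fun y hy => hW.1 y (by simp [hy]), (List.pairwise_cons.1 hW.2).2⟩
        ⟨fun y hy => hW'.1 y (by simp [hy]), (List.pairwise_cons.1 hW'.2).2⟩ (by simpa using h)

end LyndonFactorization

/-! ### Leading terms of bracketed words -/

section LeadingTerm

variable {k : Type u} {H : Type v} [Field k] [Ring H] [HopfAlgebra k H]

section

variable {A B C D T : Type*} [AddCommGroup A] [Module k A] [AddCommGroup B] [Module k B]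
  [AddCommGroup C] [Module k C] [AddCommGroup D] [Module k D] [Ring T] [Algebra k T]

theorem mul'_map_assoc_symm (f : A →ₗ[k] T) (g : B →ₗ[k] T) (h : C →ₗ[k] T)
    (s : D →ₗ[k] B ⊗[k] C) (q : D →ₗ[k] T)
    (hs : ∀ y, LinearMap.mul' k T (TensorProduct.map g h (s y)) = q y) (x : A ⊗[k] D) :
    LinearMap.mul' k T (TensorProduct.map (LinearMap.mul' k T ∘ₗ TensorProduct.map f g) h
      ((TensorProduct.assoc k A B C).symm (TensorProduct.map LinearMap.id s x))) =
      LinearMap.mul' k T (TensorProduct.map f q x) := by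
  induction x with
  | zero => simp
  | add x y hx hy => simp only [map_add, hx, hy]
  | tmul x y =>
    simp only [TensorProduct.map_tmul, LinearMap.mul'_apply, ← hs, LinearMap.id_apply]
    induction s y with
    | zero => simp
    | add a b ha hb => simp only [TensorProduct.tmul_add, map_add, mul_add, ha, hb]
    | tmul a b => simp [mul_assoc]

theorem mul'_map_mem (f : A →ₗ[k] T) (g : B →ₗ[k] T) {N : Submodule k T} (hg : ∀ y, g y ∈ N)
    (x : A ⊗[k] B) : LinearMap.mul' k T (TensorProduct.map f g x) ∈ LinearMap.range f * N := by
  induction x with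
  | zero => simp
  | add x y hx hy => simpa only [map_add] using add_mem hx hy
  | tmul x y => exact Submodule.mul_mem_mul ⟨x, rfl⟩ (hg y)

end

/-- In `y₍₀₎ ⊗ S⁻¹(y₍₋₁₎).x` the left factor stays in `P` because `P` is stable under the coaction,
and the right factor stays in `N` because `N` is stable under the action. -/
theorem braiding_symm_mul_mem (hS : Function.Bijective (HopfAlgebra.antipode k (A := H)))
    (V : YDMod k H) {N P : Submodule k (TensorAlgebra k V)} (hN : V.tensorAlgebra.IsSub N)
    (hP : V.tensorAlgebra.IsSub P) {x y : TensorAlgebra k V} (hx : x ∈ N) (hy : y ∈ P) :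
    LinearMap.mul' k (TensorAlgebra k V)
      ((braiding V.tensorAlgebra V.tensorAlgebra hS).toEquiv.symm (x ⊗ₜ y)) ∈ P * N := by
  have : (braiding V.tensorAlgebra V.tensorAlgebra hS).toEquiv.symm (x ⊗ₜ y) =
      braidingInvLin V.tensorAlgebra V.tensorAlgebra (antipodeInv hS) (x ⊗ₜ y) := rfl
  rw [this, braidingInvLin_tmul]
  obtain ⟨t, ht⟩ := hP.coact_mem y hy
  rw [← ht]
  clear ht
  induction t with
  | zero => simp
  | add s t hs ht => simpa only [map_add] using add_mem hs ht
  | tmul h z => exact Submodule.mul_mem_mul z.2 (hN.act_mem _ x hx)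

theorem bracket_tmul (hS : Function.Bijective (HopfAlgebra.antipode k (A := H)))
    (V : YDMod k H) (x y : TensorAlgebra k V) :
    (YDHom.bracket V hS).toLin (x ⊗ₜ y) = x * y - LinearMap.mul' k (TensorAlgebra k V)
      ((braiding V.tensorAlgebra V.tensorAlgebra hS).toEquiv.symm (x ⊗ₜ y)) := rfl

variable {d : ℕ} (V : Fin d → YDMod k H)

/-- The subspace `V^u` of `TV`. -/
noncomputable def wordSpace (u : List (Fin d)) : Submodule k (TensorAlgebra k (YDMod.directSum V)) :=
  (u.map fun i => LinearMap.range (YDHom.letter V i).toLin).prod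

/-- The sum of the subspaces `V^u` of `TV` over a set of words. -/
noncomputable def wordsSpace (S : Set (List (Fin d))) : Submodule k (TensorAlgebra k (YDMod.directSum V)) :=
  ⨆ u : S, wordSpace V u

theorem wordSpace_append (u v : List (Fin d)) :
    wordSpace V (u ++ v) = wordSpace V u * wordSpace V v := by
  simp [wordSpace]

theorem isSub_wordSpace (u : List (Fin d)) :
    (YDMod.directSum V).tensorAlgebra.IsSub (wordSpace V u) := by
  induction u with
  | nil =>
    have h := (YDHom.one (YDMod.directSum V)).isSub_range
    have h1 : LinearMap.range (YDHom.one (YDMod.directSum V)).toLin = wordSpace V [] := by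
      rw [wordSpace, List.map_nil, List.prod_nil, Submodule.one_eq_range]
      rfl
    rwa [h1] at h
  | cons i u ih =>
    have : wordSpace V (i :: u) = LinearMap.range (YDHom.letter V i).toLin * wordSpace V u := by
      simp [wordSpace]
    rw [this]
    exact (YDHom.letter V i).isSub_range.mul ih

theorem isSub_wordsSpace (S : Set (List (Fin d))) :
    (YDMod.directSum V).tensorAlgebra.IsSub (wordsSpace V S) :=
  YDMod.IsSub.iSup fun u : S => isSub_wordSpace V u

theorem wordSpace_le {u : List (Fin d)} {S : Set (List (Fin d))} (h : u ∈ S) :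
    wordSpace V u ≤ wordsSpace V S :=
  le_iSup (fun u : S => wordSpace V u) ⟨u, h⟩

theorem wordsSpace_mono {S S' : Set (List (Fin d))} (h : S ⊆ S') :
    wordsSpace V S ≤ wordsSpace V S' :=
  iSup_le fun u => wordSpace_le V (h u.2)

theorem wordsSpace_mul_le {S S' S'' : Set (List (Fin d))}
    (h : ∀ u ∈ S, ∀ v ∈ S', u ++ v ∈ S'') :
    wordsSpace V S * wordsSpace V S' ≤ wordsSpace V S'' := by
  rw [wordsSpace, wordsSpace, Submodule.iSup_mul]
  refine iSup_le fun u => ?_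
  rw [Submodule.mul_iSup]
  refine iSup_le fun v => ?_
  rw [← wordSpace_append]
  exact wordSpace_le V (h _ u.2 _ v.2)

/-- The words that are larger than `u` and have the same length. -/
def largerWords (u : List (Fin d)) : Set (List (Fin d)) := {v | v.length = u.length ∧ u < v}

theorem append_mem_largerWords {u v u' v' : List (Fin d)} (hu : u'.length = u.length)
    (hv : v'.length = v.length) (h : u < u' ∨ u = u' ∧ v < v') :
    u' ++ v' ∈ largerWords (u ++ v) := by
  refine ⟨by simp [hu, hv], ?_⟩
  rcases h with h | ⟨rfl, h⟩
  · exact list_append_lt_append_of_length_eq h hu _ _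
  · exact List.append_left_lt h

/-- `p` has the leading term `x`, in `V^u`, that is, `p - x` lies in the sum of the `V^{u'}` for
the larger words `u'` of the same length. -/
structure HasLeadingTerm (u : List (Fin d)) (x p : TensorAlgebra k (YDMod.directSum V)) : Prop where
  mem : x ∈ wordSpace V u
  sub_mem : p - x ∈ wordsSpace V (largerWords u)

variable {V}

/-- Among words of fixed lengths, concatenation is strictly increasing in each argument, so each
error term that involves `p - x` or `q - y` lies in larger words. -/
theorem HasLeadingTerm.mul {u v : List (Fin d)} {x p y q : TensorAlgebra k (YDMod.directSum V)}
    (h : HasLeadingTerm V u x p) (h' : HasLeadingTerm V v y q) :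
    HasLeadingTerm V (u ++ v) (x * y) (p * q) where
  mem := by
    rw [wordSpace_append]
    exact Submodule.mul_mem_mul h.mem h'.mem
  sub_mem := by
    have h1 : p * q - x * y = (p - x) * (q - y) + (p - x) * y + x * (q - y) := by noncomm_ring
    have hy := wordSpace_le V (Set.mem_singleton v) h'.mem
    have hx := wordSpace_le V (Set.mem_singleton u) h.mem
    rw [h1]
    refine add_mem (add_mem ?_ ?_) ?_
    · refine wordsSpace_mul_le V ?_ (Submodule.mul_mem_mul h.sub_mem h'.sub_mem)
      exact fun u' hu v' hv => append_mem_largerWords hu.1 hv.1 (Or.inl hu.2)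
    · refine wordsSpace_mul_le V ?_ (Submodule.mul_mem_mul h.sub_mem hy)
      rintro u' hu v' rfl
      exact append_mem_largerWords hu.1 rfl (Or.inl hu.2)
    · refine wordsSpace_mul_le V ?_ (Submodule.mul_mem_mul hx h'.sub_mem)
      rintro u' rfl v' hv
      exact append_mem_largerWords rfl hv.1 (Or.inr ⟨rfl, hv.2⟩)

theorem HasLeadingTerm.mem_wordsSpace {u : List (Fin d)}
    {x p : TensorAlgebra k (YDMod.directSum V)} (h : HasLeadingTerm V u x p) :
    p ∈ wordsSpace V {v | v.length = u.length ∧ u ≤ v} := by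
  have h1 := wordSpace_le V (S := {v | v.length = u.length ∧ u ≤ v}) ⟨rfl, le_refl u⟩ h.mem
  have h2 := wordsSpace_mono V (S' := {v | v.length = u.length ∧ u ≤ v})
    (fun v hv => ⟨hv.1, hv.2.le⟩) h.sub_mem
  simpa using add_mem h2 h1

variable (V)

theorem listMul_mem_wordSpace (u : List (Fin d)) (x : YDMod.listTensor V u) :
    (YDHom.listMul (YDHom.letter V) u).toLin x ∈ wordSpace V u := by
  induction u with
  | nil => exact Submodule.one_eq_range.ge ⟨x, rfl⟩
  | cons i u ih =>
    have : wordSpace V (i :: u) = LinearMap.range (YDHom.letter V i).toLin * wordSpace V u := by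
      simp [wordSpace]
    rw [this]
    exact mul'_map_mem _ _ ih x

/-- Splitting a tensor along a list only inserts a unit and moves parentheses, which multiplication
does not see. This identifies the product of the leading terms of the two halves with the leading
term of the whole bracket. -/
theorem listMul_listSplit {ι : Type} {W : ι → YDMod k H} {M : YDMod k H}
    (f : ∀ i, YDHom (W i) M.tensorAlgebra) (n : ℕ) (l : List ι) (x : YDMod.listTensor W l) :
    LinearMap.mul' k (TensorAlgebra k M)
      (TensorProduct.map (YDHom.listMul f (l.take n)).toLin (YDHom.listMul f (l.drop n)).toLin
        ((YDHom.listSplit W n l).toLin x)) = (YDHom.listMul f l).toLin x := by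
  induction n generalizing l with
  | zero =>
    change LinearMap.mul' k (TensorAlgebra k M) (TensorProduct.map (YDHom.one M).toLin
      (YDHom.listMul f l).toLin ((1 : k) ⊗ₜ x)) = _
    simp [YDHom.one]
  | succ n ih =>
    cases l with
    | nil =>
      change LinearMap.mul' k (TensorAlgebra k M) (TensorProduct.map (YDHom.one M).toLin
        (YDHom.listMul f []).toLin ((1 : k) ⊗ₜ x)) = _
      simp [YDHom.one]
    | cons i l => exact mul'_map_assoc_symm (f i).toLin _ _ _ _ (ih l) x

/-- Induction on the length along the Shirshov decomposition `u = vw`, whose two factors are again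
Lyndon. The ordered product contributes the leading term, and the exchanged product lies entirely in
larger words because `u < w`. -/
theorem wordBracket_hasLeadingTerm (hS : Function.Bijective (HopfAlgebra.antipode k (A := H)))
    {u : List (Fin d)} (hL : IsLyndon u) (x : YDMod.listTensor V u) :
    HasLeadingTerm V u ((YDHom.listMul (YDHom.letter V) u).toLin x)
      ((wordBracket hS V u).toLin x) := by
  refine ⟨listMul_mem_wordSpace V u x, ?_⟩
  induction hn : u.length using Nat.strong_induction_on generalizing u with
  | _ n ih =>
  by_cases hu : u.length ≤ 1
  · rw [wordBracket, if_pos hu, sub_self]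
    exact zero_mem _
  have hspec := shirshovIndex_spec hu
  have hlt := hL.lt_shirshov_right hu
  rw [wordBracket, if_neg hu, ← listMul_listSplit (YDHom.letter V) (shirshovIndex u)]
  change (YDHom.bracket (YDMod.directSum V) hS).toLin (TensorProduct.map _ _
    ((YDHom.listSplit V (shirshovIndex u) u).toLin x)) - _ ∈ _
  induction (YDHom.listSplit V (shirshovIndex u) u).toLin x using TensorProduct.induction_on with
  | zero => simp
  | add a b ha hb =>
    simp only [map_add]
    rw [add_sub_add_comm]
    exact add_mem ha hb
  | tmul a b =>
    have hA : HasLeadingTerm V _ _ _ := ⟨listMul_mem_wordSpace V _ a,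
      ih (u.take (shirshovIndex u)).length (by simp; omega) (hL.shirshov_left hu) a rfl⟩
    have hB : HasLeadingTerm V _ _ _ := ⟨listMul_mem_wordSpace V _ b,
      ih (u.drop (shirshovIndex u)).length (by simp; omega) (shirshov_right hu) b rfl⟩
    have hAB := (hA.mul hB).sub_mem
    rw [List.take_append_drop] at hAB
    rw [TensorProduct.map_tmul, TensorProduct.map_tmul, bracket_tmul, LinearMap.mul'_apply,
      sub_right_comm]
    refine sub_mem hAB ?_
    -- The exchanged product involves only words `w'v'` with `w' ≥ w` and `v' ≥ v`. The chain `u < w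
    -- ≤ w' ≤ w'v'` makes all of them larger than `u`.
    have hm := braiding_symm_mul_mem hS _ (isSub_wordsSpace V _) (isSub_wordsSpace V _)
      hA.mem_wordsSpace hB.mem_wordsSpace
    refine wordsSpace_mul_le V ?_ hm
    rintro w' ⟨hw1, hw2⟩ v' ⟨hv1, hv2⟩
    refine ⟨?_, hlt.trans_le (hw2.trans (list_le_of_prefix (List.prefix_append _ _)))⟩
    rw [List.length_append, hw1, hv1, List.length_drop, List.length_take]
    omega

end LeadingTerm

/-! ### Unitriangular families -/

section Triangular

variable {k M ω ι Γ : Type*} [Field k] [AddCommGroup M] [Module k M] [LinearOrder Γ]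
  (b : Module.Basis ω k M) (κ : ω → Γ) {f : ι → ω} {p : ι → M}

/-- In a nontrivial relation choose an index whose key is minimal. The error terms of every `p j` in
the relation have keys strictly above this minimum, so the basis vector at the chosen index occurs
only in its own `p i`. Ties between keys do no harm, since error terms have strictly larger keys. -/
theorem linearIndependent_of_triangular (hf : Function.Injective f)
    (hp : ∀ i, p i - b (f i) ∈ Submodule.span k (b '' {w | κ (f i) < κ w})) :
    LinearIndependent k p := by
  classical
  rw [linearIndependent_iff]
  intro l hl
  by_contra hne
  obtain ⟨i, hi, hmin⟩ := Finset.exists_min_image l.support (fun i => κ (f i))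
    (Finsupp.support_nonempty_iff.2 hne)
  have hcoeff (j : ι) (hj : j ∈ l.support) : b.repr (p j) (f i) = if j = i then 1 else 0 := by
    have h1 := (b.mem_span_image.1 (hp j))
    have h2 : b.repr (p j - b (f j)) (f i) = 0 := by
      by_contra h
      exact absurd (h1 (Finsupp.mem_support_iff.2 h)) (not_lt.2 (hmin j hj))
    rw [map_sub, Finsupp.sub_apply, sub_eq_zero, b.repr_self, Finsupp.single_apply] at h2
    simpa [hf.eq_iff] using h2
  have h0 : b.repr (Finsupp.linearCombination k p l) (f i) = l i := by
    rw [Finsupp.linearCombination_apply, Finsupp.sum, map_sum, Finsupp.finsetSum_apply,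
      Finset.sum_eq_single i]
    · simp [hcoeff i hi]
    · intro j hj hji
      simp [hcoeff j hj, hji]
    · simp_all
  rw [hl] at h0
  exact Finsupp.mem_support_iff.1 hi (by simpa using h0.symm)

/-- Descending induction on the key: `b w` is some `p i` minus an error with larger keys. Only the
set of keys has to be finite, not `S` itself. -/
theorem mem_span_of_triangular {S : Set ω} (hS : (κ '' S).Finite)
    (hf : ∀ w ∈ S, ∃ i, f i = w)
    (hp : ∀ i, f i ∈ S →
      p i - b (f i) ∈ Submodule.span k (b '' {w | w ∈ S ∧ κ (f i) < κ w}))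
    {w : ω} (hw : w ∈ S) : b w ∈ Submodule.span k (p '' (f ⁻¹' S)) := by
  refine (hS.wellFoundedOn (r := (· > ·))).induction
    (P := fun γ => ∀ w ∈ S, κ w = γ → b w ∈ Submodule.span k (p '' (f ⁻¹' S)))
    (Set.mem_image_of_mem κ hw) ?_ w hw rfl
  rintro _ - ih w hw rfl
  obtain ⟨i, rfl⟩ := hf w hw
  have h1 : Submodule.span k (b '' {w | w ∈ S ∧ κ (f i) < κ w}) ≤
      Submodule.span k (p '' (f ⁻¹' S)) := by
    refine Submodule.span_le.2 ?_
    rintro _ ⟨w', ⟨hw', hlt⟩, rfl⟩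
    exact ih _ (Set.mem_image_of_mem κ hw') hlt w' hw' rfl
  have h2 : p i ∈ Submodule.span k (p '' (f ⁻¹' S)) := Submodule.subset_span ⟨i, hw, rfl⟩
  simpa using sub_mem h2 (h1 (hp i hw))

end Triangular

/-! ### Bases of tensor algebras and direct sums -/

theorem basis_tensorAlgebra_apply {κ R M : Type*} [CommSemiring R] [AddCommMonoid M] [Module R M]
    (b : Module.Basis κ R M) (l : List κ) :
    b.tensorAlgebra (FreeMonoid.ofList l) = (l.map fun i => TensorAlgebra.ι R (b i)).prod := by
  have h : FreeAlgebra.basisFreeMonoid R κ (FreeMonoid.ofList l) =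
      (l.map (FreeAlgebra.ι R)).prod := by
    simp [FreeAlgebra.basisFreeMonoid, FreeAlgebra.equivMonoidAlgebraFreeMonoid,
      FreeMonoid.lift_apply]
  simp only [Module.Basis.tensorAlgebra, Module.Basis.map_apply, h]
  rw [AlgEquiv.toLinearEquiv_apply, map_list_prod, List.map_map]
  congr 1
  exact List.map_congr_left fun i _ => TensorAlgebra.equivFreeAlgebra_symm_ι b i

theorem dfinsupp_basis_apply {ι R : Type*} {M η : ι → Type*} [DecidableEq ι] [Semiring R]
    [∀ i, AddCommMonoid (M i)] [∀ i, Module R (M i)] (b : ∀ i, Module.Basis (η i) R (M i))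
    (a : Σ i, η i) : DFinsupp.basis b a = DFinsupp.single a.1 (b a.1 a.2) := by
  change (DFinsupp.mapRange.linearEquiv fun i => (b i).repr).symm
    (sigmaFinsuppLequivDFinsupp R (Finsupp.single a 1)) = _
  rw [LinearEquiv.symm_apply_eq]
  refine (sigmaFinsuppEquivDFinsupp_single a (1 : R)).trans ?_
  rw [DFinsupp.mapRange.linearEquiv_apply, DFinsupp.mapRange_single]
  simp

/-! ### The basis of products of brackets -/

section PBWBasis

variable {k : Type u} {H : Type v} [Field k] [Ring H] [HopfAlgebra k H] {d : ℕ}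
  {V : Fin d → YDMod k H} {η : Fin d → Type*} (b : ∀ i, Module.Basis (η i) k (V i))

/-- The pure tensor of basis vectors that is given by a coloured word. -/
noncomputable def wordTensor : ∀ x : List (Σ i, η i), YDMod.listTensor V (x.map Sigma.fst)
  | [] => (1 : k)
  | a :: x => (b a.1 a.2) ⊗ₜ[k] (wordTensor x)

/-- The basis of `TV` that consists of the words in basis vectors of the `V_i`. -/
noncomputable def wordBasis :
    Module.Basis (List (Σ i, η i)) k (TensorAlgebra k (YDMod.directSum V)) :=
  (Module.Basis.tensorAlgebra (M := DirectSum (Fin d) fun i => V i) (DFinsupp.basis b)).reindex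
    FreeMonoid.toList

theorem wordBasis_apply (x : List (Σ i, η i)) :
    wordBasis b x = (x.map fun a => (YDHom.letter V a.1).toLin (b a.1 a.2)).prod := by
  have h := basis_tensorAlgebra_apply (M := DirectSum (Fin d) fun i => V i) (DFinsupp.basis b) x
  rw [wordBasis, Module.Basis.reindex_apply]
  refine h.trans (congrArg List.prod (List.map_congr_left fun a _ => ?_))
  rw [dfinsupp_basis_apply]
  rfl

theorem wordBasis_nil : wordBasis b [] = 1 := by
  rw [wordBasis_apply]
  rfl

theorem wordBasis_append (x y : List (Σ i, η i)) :
    wordBasis b (x ++ y) = wordBasis b x * wordBasis b y := by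
  rw [wordBasis_apply, wordBasis_apply, wordBasis_apply, List.map_append, List.prod_append]

theorem wordBasis_cons (a : Σ i, η i) (x : List (Σ i, η i)) :
    wordBasis b (a :: x) = (YDHom.letter V a.1).toLin (b a.1 a.2) * wordBasis b x := by
  rw [wordBasis_apply, wordBasis_apply, List.map_cons, List.prod_cons]

theorem listMul_wordTensor (x : List (Σ i, η i)) :
    (YDHom.listMul (YDHom.letter V) (x.map Sigma.fst)).toLin (wordTensor b x) =
      wordBasis b x := by
  induction x with
  | nil =>
    rw [wordBasis_nil]
    exact map_one (algebraMap k (TensorAlgebra k (YDMod.directSum V)))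
  | cons a x ih =>
    rw [wordBasis_cons, ← ih]
    rfl

theorem span_wordTensor (u : List (Fin d)) :
    Submodule.span k {y : YDMod.listTensor V u |
      ∃ (x : List (Σ i, η i)) (h : x.map Sigma.fst = u), h ▸ wordTensor b x = y} = ⊤ := by
  induction u with
  | nil =>
    rw [eq_top_iff]
    intro y _
    have h1 : (1 : k) ∈ {y : YDMod.listTensor V [] |
      ∃ (x : List (Σ i, η i)) (h : x.map Sigma.fst = []), h ▸ wordTensor b x = y} :=
      ⟨[], rfl, rfl⟩
    have h2 := Submodule.smul_mem _ (show k from y) (Submodule.subset_span h1)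
    have h3 : (show k from y) • (1 : k) = y := mul_one _
    rw [h3] at h2
    exact h2
  | cons i u ih =>
    have h1 : Submodule.map₂ (TensorProduct.mk k (V i) (YDMod.listTensor V u)) ⊤ ⊤ = ⊤ :=
      TensorProduct.map₂_mk_top_top_eq_top k _ _
    rw [← ih, ← (b i).span_eq, Submodule.map₂_span_span] at h1
    refine eq_top_iff.2 (h1.ge.trans (Submodule.span_mono ?_))
    rintro _ ⟨_, ⟨j, rfl⟩, _, ⟨x, rfl, rfl⟩, rfl⟩
    exact ⟨⟨i, j⟩ :: x, rfl, rfl⟩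

variable (hS : Function.Bijective (HopfAlgebra.antipode k (A := H)))

/-- The bracket `[x]` of a word in basis vectors. -/
noncomputable def bracketWord (x : List (Σ i, η i)) : TensorAlgebra k (YDMod.directSum V) :=
  (wordBracket hS V (x.map Sigma.fst)).toLin (wordTensor b x)

theorem range_wordBracket (u : List (Fin d)) :
    LinearMap.range (wordBracket hS V u).toLin =
      Submodule.span k (bracketWord b hS '' {x | x.map Sigma.fst = u}) := by
  rw [LinearMap.range_eq_map, ← span_wordTensor b u, Submodule.map_span]
  congr 1
  ext y
  constructor
  · rintro ⟨_, ⟨x, rfl, rfl⟩, rfl⟩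
    exact ⟨x, rfl, rfl⟩
  · rintro ⟨x, rfl, rfl⟩
    exact ⟨_, ⟨x, rfl, rfl⟩, rfl⟩

theorem bracketWord_hasLeadingTerm {x : List (Σ i, η i)} (hx : IsLyndon (x.map Sigma.fst)) :
    HasLeadingTerm V (x.map Sigma.fst) (wordBasis b x) (bracketWord b hS x) := by
  rw [← listMul_wordTensor]
  exact wordBracket_hasLeadingTerm V hS hx _

/-- By multiplicativity of leading terms. The order of the factors plays no role here; it matters
only for making `W ↦ W.flatten` injective. -/
theorem prod_bracketWord_hasLeadingTerm {W : List (List (Σ i, η i))}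
    (hW : ∀ x ∈ W, IsLyndon (x.map Sigma.fst)) :
    HasLeadingTerm V (W.flatten.map Sigma.fst) (wordBasis b W.flatten)
      (W.map (bracketWord b hS)).prod := by
  induction W with
  | nil =>
    rw [List.flatten_nil, List.map_nil, List.map_nil, List.prod_nil, wordBasis_nil]
    exact ⟨by simp [wordSpace], by simp⟩
  | cons x W ih =>
    rw [List.flatten_cons, List.map_append, wordBasis_append, List.map_cons, List.prod_cons]
    exact (bracketWord_hasLeadingTerm b hS (hW x (by simp))).mul
      (ih fun y hy => hW y (by simp [hy]))

theorem wordSpace_eq_span (u : List (Fin d)) :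
    wordSpace V u = Submodule.span k (wordBasis b '' {x | x.map Sigma.fst = u}) := by
  induction u with
  | nil =>
    have h : {x : List (Σ i, η i) | x.map Sigma.fst = []} = {[]} := by ext; simp
    rw [h, Set.image_singleton, wordBasis_nil, wordSpace, List.map_nil, List.prod_nil,
      Submodule.one_eq_span]
  | cons i u ih =>
    have h1 : wordSpace V (i :: u) = LinearMap.range (YDHom.letter V i).toLin * wordSpace V u := by
      simp [wordSpace]
    rw [h1, ih, LinearMap.range_eq_map, ← (b i).span_eq, Submodule.map_span,
      Submodule.span_mul_span]
    congr 1
    ext y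
    constructor
    · rintro ⟨_, ⟨_, ⟨j, rfl⟩, rfl⟩, _, ⟨x, rfl, rfl⟩, rfl⟩
      exact ⟨⟨i, j⟩ :: x, rfl, wordBasis_cons b _ _⟩
    · rintro ⟨_ | ⟨⟨j, β⟩, x⟩, hx, rfl⟩
      · simp at hx
      · obtain ⟨rfl, rfl⟩ : j = i ∧ x.map Sigma.fst = u := by simpa using hx
        exact ⟨_, ⟨_, ⟨β, rfl⟩, rfl⟩, _, ⟨x, rfl, rfl⟩, (wordBasis_cons b ⟨j, β⟩ x).symm⟩

theorem wordsSpace_le_span (S : Set (List (Fin d))) :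
    wordsSpace V S ≤ Submodule.span k (wordBasis b '' {x | x.map Sigma.fst ∈ S}) := by
  refine iSup_le fun u => ?_
  rw [wordSpace_eq_span b]
  refine Submodule.span_mono (Set.image_mono ?_)
  intro x (hx : x.map Sigma.fst = u.1)
  rw [Set.mem_ofPred_eq, hx]
  exact u.2

theorem prod_bracketWord_sub_mem (W : lyndonFactorizations (Sigma.fst : (Σ i, η i) → Fin d)) :
    (W.1.map (bracketWord b hS)).prod - wordBasis b W.1.flatten ∈ Submodule.span k
      (wordBasis b '' {x | x.length = W.1.flatten.length ∧
        W.1.flatten.map Sigma.fst < x.map Sigma.fst}) := by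
  have h := wordsSpace_le_span b _ (prod_bracketWord_hasLeadingTerm b hS W.2.1).sub_mem
  refine Submodule.span_mono (Set.image_mono ?_) h
  rintro x ⟨hx1, hx2⟩
  exact ⟨by simpa only [List.length_map] using hx1, hx2⟩

/-- The key of a word is its colour, and uniqueness of the Lyndon factorization says that different
products have different leading basis words. -/
theorem linearIndependent_prod_bracketWord : LinearIndependent k
    fun W : lyndonFactorizations (Sigma.fst : (Σ i, η i) → Fin d) =>
      (W.1.map (bracketWord b hS)).prod := by
  refine linearIndependent_of_triangular (wordBasis b) (fun x => x.map Sigma.fst)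
    (f := fun W : lyndonFactorizations (Sigma.fst : (Σ i, η i) → Fin d) => W.1.flatten) ?_ ?_
  · exact fun W W' h => Subtype.ext (lyndonFactorization_unique W.2 W'.2 h)
  · exact fun W => Submodule.span_mono (Set.image_mono fun _ hx => hx.2)
      (prod_bracketWord_sub_mem b hS W)

/-- Existence of the Lyndon factorization makes every basis word a leading term. Working in one
length keeps the set of keys finite, even for infinite bases of the `V_i`. -/
theorem wordBasis_mem_span (n : ℕ) {x : List (Σ i, η i)} (hx : x.length = n) :
    wordBasis b x ∈ Submodule.span k
      ((fun W : lyndonFactorizations (Sigma.fst : (Σ i, η i) → Fin d) =>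
        (W.1.map (bracketWord b hS)).prod) '' {W | W.1.flatten.length = n}) := by
  refine mem_span_of_triangular (S := {x | x.length = n})
    (f := fun W : lyndonFactorizations (Sigma.fst : (Σ i, η i) → Fin d) => W.1.flatten)
    (wordBasis b) (fun x => x.map Sigma.fst) ?_ ?_ ?_ hx
  · refine (List.finite_length_eq (Fin d) n).subset ?_
    rintro _ ⟨x, rfl, rfl⟩
    simp
  · intro x _
    obtain ⟨W, hW, rfl⟩ := exists_lyndonFactorization (c := (Sigma.fst : (Σ i, η i) → Fin d)) x
    exact ⟨⟨W, hW⟩, rfl⟩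
  · rintro W rfl
    exact prod_bracketWord_sub_mem b hS W

theorem span_prod_bracketWord : ⊤ ≤ Submodule.span k (Set.range
    fun W : lyndonFactorizations (Sigma.fst : (Σ i, η i) → Fin d) =>
      (W.1.map (bracketWord b hS)).prod) := by
  rw [← (wordBasis b).span_eq, Submodule.span_le]
  rintro _ ⟨x, rfl⟩
  exact Submodule.span_mono (Set.image_subset_range _ _) (wordBasis_mem_span b hS _ rfl)

/-- The basis of `TV` that consists of the products `[x₁] ⋯ [xᵣ]` for the Lyndon factorizations
`x₁ ⋯ xᵣ` of the words in basis vectors of the `V_i`. -/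
noncomputable def pbwBasis :
    Module.Basis (lyndonFactorizations (Sigma.fst : (Σ i, η i) → Fin d)) k
      (TensorAlgebra k (YDMod.directSum V)) :=
  Module.Basis.mk (linearIndependent_prod_bracketWord b hS) (span_prod_bracketWord b hS)

theorem pbwBasis_apply (W : lyndonFactorizations (Sigma.fst : (Σ i, η i) → Fin d)) :
    pbwBasis b hS W = (W.1.map (bracketWord b hS)).prod := by
  exact Module.Basis.mk_apply _ _ _

theorem wordSpace_le_tensorGrading (u : List (Fin d)) :
    wordSpace V u ≤ tensorGrading (k := k) (YDMod.directSum V) u.length := by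
  induction u with
  | nil => simp [wordSpace, tensorGrading]
  | cons i u ih =>
    have h1 : wordSpace V (i :: u) = LinearMap.range (YDHom.letter V i).toLin * wordSpace V u := by
      simp [wordSpace]
    rw [h1, tensorGrading, List.length_cons, pow_succ']
    refine mul_le_mul' ?_ ih
    exact LinearMap.range_comp_le_range _ _

theorem tensorGrading_le_span (n : ℕ) :
    tensorGrading (k := k) (YDMod.directSum V) n ≤
      Submodule.span k (wordBasis b '' {x | x.length = n}) := by
  induction n with
  | zero =>
    rw [tensorGrading, pow_zero, Submodule.one_eq_span]
    refine Submodule.span_mono ?_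
    rintro _ rfl
    exact ⟨[], rfl, wordBasis_nil b⟩
  | succ n ih =>
    have h1 : LinearMap.range (TensorAlgebra.ι k (M := YDMod.directSum V)) ≤
        Submodule.span k (wordBasis b '' {x | x.length = 1}) := by
      rw [LinearMap.range_eq_map,
        ← (Module.Basis.span_eq (M := DirectSum (Fin d) fun i => V i) (DFinsupp.basis b)),
        Submodule.map_span]
      refine Submodule.span_mono ?_
      rintro _ ⟨_, ⟨a, rfl⟩, rfl⟩
      refine ⟨[a], rfl, ?_⟩
      rw [dfinsupp_basis_apply, wordBasis_apply]
      simp only [List.map_cons, List.map_nil, List.prod_cons, List.prod_nil, mul_one]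
      rfl
    rw [tensorGrading, pow_succ']
    refine (mul_le_mul' h1 ih).trans ?_
    rw [Submodule.span_mul_span]
    refine Submodule.span_mono ?_
    rintro _ ⟨_, ⟨x, hx, rfl⟩, _, ⟨y, hy, rfl⟩, rfl⟩
    refine ⟨x ++ y, ?_, wordBasis_append b x y⟩
    simp_all [add_comm]

/-- The basis is homogeneous: a product of brackets differs from its leading word only by words of
the same length, and conversely the triangular reduction of a word never leaves its length. -/
theorem tensorGrading_eq_span (n : ℕ) :
    tensorGrading (k := k) (YDMod.directSum V) n =
      Submodule.span k (pbwBasis b hS '' {W | W.1.flatten.length = n}) := by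
  apply le_antisymm
  · refine (tensorGrading_le_span b n).trans (Submodule.span_le.2 ?_)
    rintro _ ⟨x, hx, rfl⟩
    have h : ⇑(pbwBasis b hS) = fun W => (W.1.map (bracketWord b hS)).prod :=
      funext (pbwBasis_apply b hS)
    rw [h]
    exact wordBasis_mem_span b hS n hx
  · refine Submodule.span_le.2 ?_
    rintro _ ⟨W, rfl, rfl⟩
    rw [pbwBasis_apply]
    have h : wordsSpace V {v | v.length = (W.1.flatten.map Sigma.fst).length ∧
        W.1.flatten.map Sigma.fst ≤ v} ≤
        tensorGrading (k := k) (YDMod.directSum V) W.1.flatten.length := by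
      refine iSup_le fun u => ?_
      have hu : u.1.length = W.1.flatten.length := u.2.1.trans (List.length_map _)
      exact (wordSpace_le_tensorGrading u.1).trans_eq (by rw [hu])
    exact h (prod_bracketWord_hasLeadingTerm b hS W.2.1).mem_wordsSpace

end PBWBasis

/-! ### Morphisms of Yetter–Drinfeld modules -/

section YDHom

variable {k : Type u} {H : Type v} [Field k] [Ring H] [HopfAlgebra k H]

theorem YDHom.exists_ydIso_sub {M N : YDMod k H} (f : YDHom M N)
    (hf : Function.Injective f.toLin) {P : Submodule k N} (hP : N.IsSub P)
    (h : LinearMap.range f.toLin = P) :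
    ∃ e : YDIso M (N.sub P hP), ∀ x, (e.toEquiv x : N) = f.toLin x := by
  subst h
  refine ⟨⟨LinearEquiv.ofInjective f.toLin hf, fun h v => Subtype.ext (f.map_act h v),
    fun v => ?_⟩, fun x => rfl⟩
  -- The coaction on the submodule is known only through the embedding into `H ⊗ N`, so colinearity
  -- is checked there.
  apply lTensor_subtype_injective
  rw [lTensor_subCoact, ← LinearMap.comp_apply, ← LinearMap.lTensor_comp]
  exact f.map_coact v

/-- The morphism from a direct sum that is given by a family of morphisms. -/
noncomputable def YDHom.directSumDesc {ι : Type} [DecidableEq ι] {W : ι → YDMod k H}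
    {N : YDMod k H} (f : ∀ i, YDHom (W i) N) : YDHom (YDMod.directSum W) N where
  toLin := DirectSum.toModule k ι N fun i => (f i).toLin
  map_act h v := by
    induction v using DirectSum.induction_on with
    | zero => simp
    | of i x => simp [← DirectSum.lof_eq_of k, (f i).map_act]
    | add x y hx hy => simp only [map_add, hx, hy]
  map_coact v := by
    induction v using DirectSum.induction_on with
    | zero => simp
    | of i x =>
      rw [← DirectSum.lof_eq_of k, DirectSum.toModule_lof, DirectSum.toModule_lof,
        (f i).map_coact, LinearMap.comp_apply, ← LinearMap.lTensor_comp_apply]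
      congr 2
      ext x
      simp
    | add x y hx hy => simp only [map_add, hx, hy]

/-- The morphism from an ordered product that is given by a family of morphisms. -/
noncomputable def YDHom.ordProdDesc {ι : Type} [LinearOrder ι] {W : ι → YDMod k H}
    {N : YDMod k H}
    (f : ∀ l : {l : List ι // l ≠ [] ∧ l.Pairwise (· > ·)}, YDHom (YDMod.listTensor W l.1) N) :
    YDHom (YDMod.ordProd W) N :=
  YDHom.directSumDesc f

end YDHom

/-! ### Spanning families -/

section

variable {k M N ι : Type*} [Field k] [AddCommGroup M] [Module k M] [AddCommGroup N] [Module k N]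

/-- An element of the kernel, written in the spanning family, gives a linear relation between the
images, so all its coefficients vanish. -/
theorem injective_of_linearIndependent_comp (f : M →ₗ[k] N) {e : ι → M}
    (he : Submodule.span k (Set.range e) = ⊤) (h : LinearIndependent k fun i => f (e i)) :
    Function.Injective f := by
  rw [← LinearMap.ker_eq_bot, LinearMap.ker_eq_bot']
  intro x hx
  obtain ⟨l, rfl⟩ : x ∈ LinearMap.range (Finsupp.linearCombination k e) := by
    rw [Finsupp.range_linearCombination, he]
    trivial
  have hl : Finsupp.linearCombination k (fun i => f (e i)) l = 0 := by
    rw [← hx, Finsupp.linearCombination_apply, Finsupp.linearCombination_apply, map_finsuppSum]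
    simp
  rw [linearIndependent_iff.1 h l hl, map_zero]

theorem range_ι_pow_eq_span (s : ι → M) (hs : Submodule.span k (Set.range s) = ⊤) (n : ℕ) :
    LinearMap.range (TensorAlgebra.ι k (M := M)) ^ n = Submodule.span k
      ((fun g : List ι => (g.map fun i => TensorAlgebra.ι k (s i)).prod) ''
        {g | g.length = n}) := by
  induction n with
  | zero =>
    have : {g : List ι | g.length = 0} = {[]} := by ext; simp
    rw [this, pow_zero, Submodule.one_eq_span, Set.image_singleton]
    rfl
  | succ n ih =>
    rw [pow_succ', ih, LinearMap.range_eq_map, ← hs, Submodule.map_span, Submodule.span_mul_span]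
    congr 1
    ext y
    constructor
    · rintro ⟨_, ⟨_, ⟨i, rfl⟩, rfl⟩, _, ⟨g, rfl, rfl⟩, rfl⟩
      exact ⟨i :: g, rfl, by simp⟩
    · rintro ⟨_ | ⟨i, g⟩, hg, rfl⟩
      · simp at hg
      · exact ⟨_, ⟨_, ⟨i, rfl⟩, rfl⟩, _, ⟨g, by simpa using hg, rfl⟩, by simp⟩

end

/-! ### Grouping Lyndon factorizations into blocks of equal colour -/

section Blocks

variable {d : ℕ} (η : Fin d → Type w)

/-- The words in basis vectors of the `V_i` that have a given Lyndon word as their colour. -/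
abbrev ColouredWord (u : LyndonWord d) : Type _ := {x : List (Σ i, η i) // x.map Sigma.fst = u.1}

/-- The choices of a nonempty sequence of words of colour `u` for each entry `u` of a list. -/
def BlockSeq : List (LyndonWord d) → Type w
  | [] => PUnit
  | u :: l => {g : List (ColouredWord η u) // g ≠ []} × BlockSeq l

variable {η}

/-- The concatenation of the chosen sequences. -/
def BlockSeq.blocks : ∀ {l : List (LyndonWord d)}, BlockSeq η l → List (List (Σ i, η i))
  | [], _ => []
  | _ :: _, j => j.1.1.map Subtype.val ++ BlockSeq.blocks j.2

theorem BlockSeq.exists_colour {l : List (LyndonWord d)} (j : BlockSeq η l)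
    {x : List (Σ i, η i)} (hx : x ∈ j.blocks) : ∃ u ∈ l, x.map Sigma.fst = u.1 := by
  induction l with
  | nil => simp [blocks] at hx
  | cons u l ih =>
    rcases List.mem_append.1 hx with hx | hx
    · obtain ⟨y, -, rfl⟩ := List.mem_map.1 hx
      exact ⟨u, by simp, y.2⟩
    · obtain ⟨w, hw, h⟩ := ih j.2 hx
      exact ⟨w, by simp [hw], h⟩

theorem BlockSeq.blocks_mem {l : List (LyndonWord d)} (hl : l.Pairwise (· > ·))
    (j : BlockSeq η l) : j.blocks ∈ lyndonFactorizations (Sigma.fst : (Σ i, η i) → Fin d) := by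
  refine ⟨fun x hx => ?_, ?_⟩
  · obtain ⟨u, -, h⟩ := j.exists_colour hx
    rw [h]
    exact u.2
  · induction l with
    | nil => exact List.Pairwise.nil
    | cons u l ih =>
      have hl := List.pairwise_cons.1 hl
      refine List.pairwise_append.2 ⟨?_, ih hl.2 j.2, ?_⟩
      · refine List.pairwise_of_forall_mem_list fun x hx y hy => ?_
        obtain ⟨x, -, rfl⟩ := List.mem_map.1 hx
        obtain ⟨y, -, rfl⟩ := List.mem_map.1 hy
        rw [x.2, y.2]
      · intro x hx y hy
        obtain ⟨x, -, rfl⟩ := List.mem_map.1 hx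
        obtain ⟨w, hw, h⟩ := j.2.exists_colour hy
        rw [x.2, h]
        exact (hl.1 w hw).le

/-- Blocks are nonempty, so the first factor reveals the first colour `u`. All later colours are
smaller than `u`, hence filtering by colour separates the first block from the rest, and induction
applies. -/
theorem BlockSeq.blocks_injective {l l' : List (LyndonWord d)} (hl : l.Pairwise (· > ·))
    (hl' : l'.Pairwise (· > ·)) (j : BlockSeq η l) (j' : BlockSeq η l')
    (h : j.blocks = j'.blocks) :
    (⟨l, j⟩ : Σ l : List (LyndonWord d), BlockSeq η l) = ⟨l', j'⟩ := by
  induction l generalizing l' with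
  | nil =>
    cases l' with
    | nil => rfl
    | cons u' l' =>
      obtain ⟨⟨g', hg'⟩, j'⟩ := j'
      exact absurd (List.map_eq_nil_iff.1 (List.append_eq_nil_iff.1 h.symm).1) hg'
  | cons u l ih =>
    obtain ⟨⟨g, hg⟩, j⟩ := j
    cases l' with
    | nil => exact absurd (List.map_eq_nil_iff.1 (List.append_eq_nil_iff.1 h).1) hg
    | cons u' l' =>
      obtain ⟨⟨g', hg'⟩, j'⟩ := j'
      have hl := List.pairwise_cons.1 hl
      have hl' := List.pairwise_cons.1 hl'
      change g.map Subtype.val ++ j.blocks = g'.map Subtype.val ++ j'.blocks at h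
      have huu : u = u' := by
        cases g with
        | nil => exact absurd rfl hg
        | cons x g =>
          cases g' with
          | nil => exact absurd rfl hg'
          | cons x' g' =>
            have hx : x.1 = x'.1 := by simpa using (List.cons.inj h).1
            exact Subtype.ext (x.2.symm.trans (hx ▸ x'.2))
      subst huu
      have hfilter (G : List (ColouredWord η u)) (m : List (LyndonWord d))
          (hm : ∀ w ∈ m, u > w) (i : BlockSeq η m) :
          (G.map Subtype.val ++ i.blocks).filter (fun x => x.map Sigma.fst = u.1) =
            G.map Subtype.val ∧
          (G.map Subtype.val ++ i.blocks).filter (fun x => ¬ x.map Sigma.fst = u.1) =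
            i.blocks := by
        have h1 : ∀ x ∈ i.blocks, ¬ x.map Sigma.fst = u.1 := by
          intro x hx hxu
          obtain ⟨w, hw, h⟩ := i.exists_colour hx
          exact (hm w hw).ne (Subtype.ext (h.symm.trans hxu))
        have h2 : ∀ x ∈ G.map Subtype.val, x.map Sigma.fst = u.1 := by
          intro x hx
          obtain ⟨x, -, rfl⟩ := List.mem_map.1 hx
          exact x.2
        constructor
        · rw [List.filter_append, List.filter_eq_self.2 (by simpa using h2),
            List.filter_eq_nil_iff.2 (by simpa using h1), List.append_nil]
        · rw [List.filter_append, List.filter_eq_nil_iff.2 (by simpa using h2),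
            List.filter_eq_self.2 (by simpa using h1), List.nil_append]
      have h1 := hfilter g l hl.1 j
      have h2 := hfilter g' l' hl'.1 j'
      rw [h] at h1
      have hg : g = g' := Subtype.val_injective.list_map (h1.1.symm.trans h2.1)
      subst hg
      have := ih hl.2 hl'.2 j j' (h1.2.symm.trans h2.2)
      cases this
      rfl

/-- Built up from the right: a new first factor joins the first block if it has the same colour, and
opens a block of its own if its colour is larger. -/
theorem BlockSeq.exists_blocks_eq {W : List (List (Σ i, η i))}
    (hW : W ∈ lyndonFactorizations (Sigma.fst : (Σ i, η i) → Fin d)) :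
    ∃ (l : List (LyndonWord d)) (j : BlockSeq η l), l.Pairwise (· > ·) ∧ j.blocks = W := by
  induction W with
  | nil => exact ⟨[], PUnit.unit, List.Pairwise.nil, rfl⟩
  | cons x W ih =>
    have hW2 := List.pairwise_cons.1 hW.2
    obtain ⟨l, j, hl, rfl⟩ := ih ⟨fun y hy => hW.1 y (by simp [hy]), hW2.2⟩
    let u : LyndonWord d := ⟨x.map Sigma.fst, hW.1 x (by simp)⟩
    cases l with
    | nil => exact ⟨[u], ⟨⟨[⟨x, rfl⟩], by simp⟩, j⟩, by simp, rfl⟩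
    | cons w l =>
      obtain ⟨⟨g, hg⟩, j⟩ := j
      -- The first block is nonempty, and its first entry has colour `w` and comes after `x` in a
      -- nonincreasing sequence.
      have hwu : w ≤ u := by
        cases g with
        | nil => exact absurd rfl hg
        | cons y g =>
          have := hW2.1 y.1 (by simp [blocks])
          rw [y.2] at this
          exact this
      rcases hwu.eq_or_lt with hwu | hwu
      · have hx : x.map Sigma.fst = w.1 := congrArg Subtype.val hwu.symm
        exact ⟨w :: l, ⟨⟨⟨x, hx⟩ :: g, by simp⟩, j⟩, hl, rfl⟩
      · refine ⟨u :: w :: l, ⟨⟨[⟨x, rfl⟩], by simp⟩, ⟨⟨g, hg⟩, j⟩⟩, ?_, rfl⟩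
        refine List.pairwise_cons.2 ⟨fun y hy => ?_, hl⟩
        rcases List.mem_cons.1 hy with rfl | hy
        · exact hwu
        · exact ((List.pairwise_cons.1 hl).1 y hy).trans hwu

end Blocks

/-! ### The multiplication map is an isomorphism -/

section MultiplicationMap

variable {k : Type u} {H : Type v} [Field k] [Ring H] [HopfAlgebra k H] {d : ℕ}
  {V : Fin d → YDMod k H} {η : Fin d → Type w} (b : ∀ i, Module.Basis (η i) k (V i))
  (hS : Function.Bijective (HopfAlgebra.antipode k (A := H)))

/-- The vectors `[x]` that span `V^{[u]}`. -/
noncomputable def bracketLetter (u : LyndonWord d) (x : ColouredWord η u) : lyndonSpace hS V u :=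
  ⟨bracketWord b hS x.1, (range_wordBracket b hS u.1).ge (Submodule.subset_span ⟨x.1, x.2, rfl⟩)⟩

theorem span_bracketLetter (u : LyndonWord d) :
    Submodule.span k (Set.range (bracketLetter b hS u)) = ⊤ := by
  apply Submodule.map_injective_of_injective
    (LinearMap.range (wordBracket hS V u.1).toLin).injective_subtype
  rw [Submodule.map_span, Submodule.map_top, Submodule.range_subtype]
  refine Eq.trans ?_ (range_wordBracket b hS u.1).symm
  congr 1
  ext y
  constructor
  · rintro ⟨_, ⟨x, rfl⟩, rfl⟩
    exact ⟨x.1, x.2, rfl⟩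
  · rintro ⟨x, hx, rfl⟩
    exact ⟨_, ⟨⟨x, hx⟩, rfl⟩, rfl⟩

/-- The product of the `[x]` for a nonempty sequence of words `x` of colour `u`. -/
noncomputable def bracketProd (u : LyndonWord d) (g : {g : List (ColouredWord η u) // g ≠ []}) :
    (lyndonSpace hS V u).tensorPlus :=
  ⟨(g.1.map fun x => TensorAlgebra.ι k (bracketLetter b hS u x)).prod, by
    -- The summand with index `m` of `T⁺` is the power with exponent `m + 1`, so `m` is the length
    -- of `g` minus one.
    obtain ⟨m, hm⟩ := Nat.exists_eq_succ_of_ne_zero (List.length_pos_of_ne_nil g.2).ne'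
    refine le_iSup (fun n : ℕ => LinearMap.range (TensorAlgebra.ι k
      (M := lyndonSpace hS V u)) ^ (n + 1)) m ?_
    rw [range_ι_pow_eq_span _ (span_bracketLetter b hS u)]
    exact Submodule.subset_span ⟨g.1, hm, rfl⟩⟩

theorem span_bracketProd (u : LyndonWord d) :
    Submodule.span k (Set.range (bracketProd b hS u)) = ⊤ := by
  apply Submodule.map_injective_of_injective
    (tensorPlusSubmodule (k := k) (lyndonSpace hS V u)).injective_subtype
  rw [Submodule.map_span, Submodule.map_top, Submodule.range_subtype]
  apply le_antisymm
  · rw [Submodule.span_le]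
    rintro _ ⟨y, -, rfl⟩
    exact y.2
  · refine iSup_le fun n => ?_
    rw [range_ι_pow_eq_span _ (span_bracketLetter b hS u)]
    refine Submodule.span_mono ?_
    rintro _ ⟨g, hg, rfl⟩
    exact ⟨_, ⟨⟨g, by rintro rfl; simp at hg⟩, rfl⟩, rfl⟩

/-- The pure tensor of products of vectors `[x]` that is given by a choice of blocks. -/
noncomputable def blockTensor : ∀ l : List (LyndonWord d), BlockSeq η l →
    YDMod.listTensor (fun u : LyndonWord d => (lyndonSpace hS V u).tensorPlus) l
  | [], _ => (1 : k)
  | u :: l, j => (bracketProd b hS u j.1) ⊗ₜ[k] (blockTensor l j.2)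

theorem span_blockTensor (l : List (LyndonWord d)) :
    Submodule.span k (Set.range (blockTensor b hS l)) = ⊤ := by
  induction l with
  | nil =>
    rw [eq_top_iff]
    intro y _
    have h1 : (1 : k) ∈ Set.range (blockTensor b hS []) := ⟨PUnit.unit, rfl⟩
    have h2 := Submodule.smul_mem _ (show k from y) (Submodule.subset_span h1)
    have h3 : (show k from y) • (1 : k) = y := mul_one _
    rw [h3] at h2
    exact h2
  | cons u l ih =>
    have h1 : Submodule.map₂ (TensorProduct.mk k (lyndonSpace hS V u).tensorPlus
        (YDMod.listTensor (fun u : LyndonWord d => (lyndonSpace hS V u).tensorPlus) l)) ⊤ ⊤ = ⊤ :=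
      TensorProduct.map₂_mk_top_top_eq_top k _ _
    rw [← ih, ← span_bracketProd b, Submodule.map₂_span_span] at h1
    refine eq_top_iff.2 (h1.ge.trans (Submodule.span_mono ?_))
    rintro _ ⟨_, ⟨g, rfl⟩, _, ⟨j, rfl⟩, rfl⟩
    exact ⟨(g, j), rfl⟩

theorem lyndonLift_bracketProd (u : LyndonWord d)
    (g : {g : List (ColouredWord η u) // g ≠ []}) :
    (lyndonLift hS V u).toLin (bracketProd b hS u g).1 =
      ((g.1.map Subtype.val).map (bracketWord b hS)).prod := by
  change TensorAlgebra.lift k _ (List.map _ g.1).prod = _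
  rw [map_list_prod, List.map_map, List.map_map]
  congr 1
  refine List.map_congr_left fun x _ => ?_
  exact TensorAlgebra.lift_ι_apply _ _

theorem listMul_blockTensor (l : List (LyndonWord d)) (j : BlockSeq η l) :
    (YDHom.listMul (fun u : LyndonWord d => (lyndonLift hS V u).comp
      (YDHom.subtype (isSub_tensorPlusSubmodule (lyndonSpace hS V u)))) l).toLin
        (blockTensor b hS l j) = (j.blocks.map (bracketWord b hS)).prod := by
  induction l with
  | nil => exact map_one (algebraMap k (TensorAlgebra k (YDMod.directSum V)))
  | cons u l ih =>
    rw [BlockSeq.blocks, List.map_append, List.prod_append, ← lyndonLift_bracketProd, ← ih]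
    rfl

/-- The index set of the basis vectors of the ordered product of the `T⁺V^{[u]}`. -/
abbrev BlockIndex (η : Fin d → Type w) : Type w :=
  Σ l : {l : List (LyndonWord d) // l ≠ [] ∧ l.Pairwise (· > ·)}, BlockSeq η l.1

/-- The vectors that span the ordered product of the `T⁺V^{[u]}`. -/
noncomputable def blockVector (a : BlockIndex η) :
    YDMod.ordProd fun u : LyndonWord d => (lyndonSpace hS V u).tensorPlus :=
  DirectSum.lof k _ (fun l : {l : List (LyndonWord d) // l ≠ [] ∧ l.Pairwise (· > ·)} =>
    (YDMod.listTensor (fun u : LyndonWord d => (lyndonSpace hS V u).tensorPlus) l.1).carrier) a.1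
    (blockTensor b hS a.1.1 a.2)

theorem span_blockVector : Submodule.span k (Set.range (blockVector b hS)) = ⊤ := by
  rw [eq_top_iff]
  rintro x -
  induction x using DirectSum.induction_on with
  | zero => exact zero_mem _
  | add x y hx hy => exact add_mem hx hy
  | of l x =>
    rw [← DirectSum.lof_eq_of k]
    have hx : x ∈ Submodule.span k (Set.range (blockTensor b hS l.1)) := by
      rw [span_blockTensor]
      trivial
    have := Submodule.mem_map_of_mem (f := DirectSum.lof k _
      (fun l : {l : List (LyndonWord d) // l ≠ [] ∧ l.Pairwise (· > ·)} =>
        (YDMod.listTensor (fun u : LyndonWord d =>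
          (lyndonSpace hS V u).tensorPlus) l.1).carrier) l) hx
    rw [Submodule.map_span] at this
    refine Submodule.span_mono ?_ this
    rintro _ ⟨_, ⟨j, rfl⟩, rfl⟩
    exact ⟨⟨l, j⟩, rfl⟩

/-- Multiplying out a pure tensor of block products concatenates the blocks, and because the colours
of the blocks decrease the result is a basis element and not merely some product of brackets. -/
theorem multiplicationMap_blockVector (a : BlockIndex η) :
    multiplicationMap hS V (blockVector b hS a) =
      pbwBasis b hS ⟨a.2.blocks, a.2.blocks_mem a.1.2.2⟩ := by
  rw [pbwBasis_apply, ← listMul_blockTensor]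
  exact DirectSum.toModule_lof _ _ _

/-- The spanning vectors go to distinct basis elements of `TV`, hence to an independent family. -/
theorem multiplicationMap_injective_of_basis (b : ∀ i, Module.Basis (η i) k (V i)) :
    Function.Injective (multiplicationMap hS V) := by
  refine injective_of_linearIndependent_comp _ (span_blockVector b hS) ?_
  have h : (fun a => multiplicationMap hS V (blockVector b hS a)) =
      fun a => pbwBasis b hS ⟨a.2.blocks, a.2.blocks_mem a.1.2.2⟩ :=
    funext (multiplicationMap_blockVector b hS)
  rw [h]
  refine (pbwBasis b hS).linearIndependent.comp
    (fun a : BlockIndex η => ⟨a.2.blocks, a.2.blocks_mem a.1.2.2⟩) ?_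
  rintro ⟨⟨l, hl⟩, j⟩ ⟨⟨l', hl'⟩, j'⟩ h
  have := BlockSeq.blocks_injective hl.2 hl'.2 j j' (congrArg Subtype.val h)
  cases this
  rfl

/-- The block vectors hit exactly the basis elements of nonempty factorizations. Since Lyndon words
are nonempty, these are the basis elements of positive degree, which span `T⁺V`. -/
theorem range_multiplicationMap_of_basis (b : ∀ i, Module.Basis (η i) k (V i)) :
    LinearMap.range (multiplicationMap hS V) =
      tensorPlusSubmodule (k := k) (YDMod.directSum V) := by
  have h1 : LinearMap.range (multiplicationMap hS V) =
      Submodule.span k (pbwBasis b hS '' {W | W.1 ≠ []}) := by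
    rw [LinearMap.range_eq_map, ← span_blockVector b, Submodule.map_span]
    congr 1
    ext y
    constructor
    · rintro ⟨_, ⟨⟨⟨l, hl⟩, j⟩, rfl⟩, rfl⟩
      refine ⟨_, ?_, (multiplicationMap_blockVector b hS _).symm⟩
      intro h
      -- The empty list of colours has the empty sequence of blocks, so by injectivity no other list
      -- does.
      have := BlockSeq.blocks_injective hl.2 List.Pairwise.nil j PUnit.unit h
      exact hl.1 (congrArg Sigma.fst this)
    · rintro ⟨⟨W, hW⟩, hne, rfl⟩
      obtain ⟨l, j, hl, rfl⟩ := BlockSeq.exists_blocks_eq hW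
      have hl0 : l ≠ [] := by rintro rfl; exact hne rfl
      exact ⟨_, ⟨⟨⟨l, hl0, hl⟩, j⟩, rfl⟩, multiplicationMap_blockVector b hS _⟩
  have h2 : tensorPlusSubmodule (k := k) (YDMod.directSum V) =
      ⨆ n : ℕ, tensorGrading (k := k) (YDMod.directSum V) (n + 1) := rfl
  rw [h1, h2]
  apply le_antisymm
  · rw [Submodule.span_le]
    rintro _ ⟨⟨W, hW⟩, hne, rfl⟩
    have hlen : W.flatten.length ≠ 0 := by
      intro h0
      cases W with
      | nil => exact hne rfl
      | cons x W =>
        have hx : x = [] := by simp at h0; exact h0.1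
        exact (hW.1 x (by simp)).1 (by simp [hx])
    obtain ⟨n, hn⟩ := Nat.exists_eq_succ_of_ne_zero hlen
    refine le_iSup (fun n : ℕ => tensorGrading (k := k) (YDMod.directSum V) (n + 1)) n ?_
    rw [tensorGrading_eq_span b hS]
    exact Submodule.subset_span ⟨⟨W, hW⟩, hn, rfl⟩
  · refine iSup_le fun n => ?_
    rw [tensorGrading_eq_span b hS]
    refine Submodule.span_mono (Set.image_mono ?_)
    rintro ⟨W, hW⟩ hn rfl
    simp at hn

variable (V) in
/-- The multiplication map as a morphism of Yetter-Drinfeld modules. -/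
noncomputable def multiplicationHom :
    YDHom (YDMod.ordProd fun u : LyndonWord d => (lyndonSpace hS V u).tensorPlus)
      (YDMod.directSum V).tensorAlgebra :=
  YDHom.ordProdDesc fun l : {l : List (LyndonWord d) // l ≠ [] ∧ l.Pairwise (· > ·)} =>
    YDHom.listMul (fun u : LyndonWord d => (lyndonLift hS V u).comp
      (YDHom.subtype (isSub_tensorPlusSubmodule (lyndonSpace hS V u)))) l.1

theorem multiplicationHom_toLin : (multiplicationHom V hS).toLin = multiplicationMap hS V := by
  unfold multiplicationHom YDHom.ordProdDesc YDHom.directSumDesc multiplicationMap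
  congr!

theorem exists_ydIso_multiplicationMap (V : Fin d → YDMod k H) :
    ∃ e : YDIso (YDMod.ordProd fun u : LyndonWord d => (lyndonSpace hS V u).tensorPlus)
        (YDMod.directSum V).tensorPlus,
      ∀ x, (e.toEquiv x : TensorAlgebra k (YDMod.directSum V)) = multiplicationMap hS V x := by
  have b := fun i => Module.Basis.ofVectorSpace k (V i)
  have hinj := multiplicationMap_injective_of_basis hS b
  have hrange := range_multiplicationMap_of_basis hS b
  rw [← multiplicationHom_toLin] at hinj hrange ⊢
  exact (multiplicationHom V hS).exists_ydIso_sub hinj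
    (isSub_tensorPlusSubmodule (YDMod.directSum V)) hrange

end MultiplicationMap

/-! ### Counting Lyndon factorizations -/

section Counting

variable {d : ℕ} {X : Type*} (c : X → Fin d)

/-- The Lyndon factorizations of words of length `n` whose factors have colours in `s`. -/
def factorizationsOn (s : Set (LyndonWord d)) (n : ℕ) : Set (List (List X)) :=
  {W | W ∈ lyndonFactorizations c ∧ (∀ x ∈ W, ∃ u ∈ s, x.map c = u.1) ∧ W.flatten.length = n}

theorem finite_factorizationsOn [Finite X] (s : Set (LyndonWord d)) (n : ℕ) :
    (factorizationsOn c s n).Finite := by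
  refine Set.Finite.of_finite_image (f := List.flatten)
    ((List.finite_length_eq X n).subset ?_) ?_
  · rintro _ ⟨W, hW, rfl⟩
    exact hW.2.2
  · exact fun W hW W' hW' h => lyndonFactorization_unique hW.1 hW'.1 h

variable {c}

/-- In a nonincreasing sequence bounded by `a`, the entries of colour `a` form an initial segment.
-/
theorem filter_colour_append {a : List (Fin d)} {W : List (List X)}
    (hW : W.Pairwise fun x y => y.map c ≤ x.map c) (ha : ∀ x ∈ W, x.map c ≤ a) :
    W.filter (fun x => x.map c = a) ++ W.filter (fun x => ¬ x.map c = a) = W := by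
  induction W with
  | nil => rfl
  | cons x W ih =>
    have hW := List.pairwise_cons.1 hW
    by_cases hx : x.map c = a
    · have := ih hW.2 fun y hy => ha y (by simp [hy])
      rw [List.filter_cons_of_pos (by simpa using hx), List.filter_cons_of_neg (by simpa using hx),
        List.cons_append, this]
    · have hlt : ∀ y ∈ x :: W, ¬ y.map c = a := by
        intro y hy hya
        rcases List.mem_cons.1 hy with rfl | hy
        · exact hx hya
        · exact hx (le_antisymm (ha x (by simp)) (hya ▸ hW.1 y hy))
      rw [List.filter_eq_nil_iff.2 (by simpa using hlt),
        List.filter_eq_self.2 (by simpa using hlt), List.nil_append]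

theorem append_mem_factorizationsOn {s : Set (LyndonWord d)} {a : LyndonWord d}
    (ha : ∀ u ∈ s, u < a) {i j : ℕ} {g W : List (List X)} (hg : g ∈ factorizationsOn c {a} i)
    (hW : W ∈ factorizationsOn c s j) : g ++ W ∈ factorizationsOn c (insert a s) (i + j) := by
  refine ⟨⟨fun x hx => ?_, ?_⟩, fun x hx => ?_, ?_⟩
  · rcases List.mem_append.1 hx with hx | hx
    · exact hg.1.1 x hx
    · exact hW.1.1 x hx
  · refine List.pairwise_append.2 ⟨hg.1.2, hW.1.2, fun x hx y hy => ?_⟩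
    obtain ⟨_, rfl, hx⟩ := hg.2.1 x hx
    obtain ⟨u, hu, hy⟩ := hW.2.1 y hy
    rw [hx, hy]
    exact (ha u hu).le
  · rcases List.mem_append.1 hx with hx | hx
    · obtain ⟨_, rfl, hx⟩ := hg.2.1 x hx
      exact ⟨_, Set.mem_insert _ _, hx⟩
    · obtain ⟨u, hu, hx⟩ := hW.2.1 x hx
      exact ⟨u, Set.mem_insert_of_mem _ hu, hx⟩
  · rw [List.flatten_append, List.length_append, hg.2.2, hW.2.2]

theorem filter_append_of_factorizationsOn {s : Set (LyndonWord d)} {a : LyndonWord d}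
    (ha : ∀ u ∈ s, u < a) {i j : ℕ} {g W : List (List X)} (hg : g ∈ factorizationsOn c {a} i)
    (hW : W ∈ factorizationsOn c s j) :
    (g ++ W).filter (fun x => x.map c = a.1) = g ∧
      (g ++ W).filter (fun x => ¬ x.map c = a.1) = W := by
  have h1 : ∀ x ∈ W, ¬ x.map c = a.1 := by
    intro x hx hxa
    obtain ⟨w, hw, h⟩ := hW.2.1 x hx
    exact (ha w hw).ne (Subtype.ext (h.symm.trans hxa))
  have h2 : ∀ x ∈ g, x.map c = a.1 := by
    intro x hx
    obtain ⟨_, rfl, hx⟩ := hg.2.1 x hx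
    exact hx
  constructor
  · rw [List.filter_append, List.filter_eq_self.2 (by simpa using h2),
      List.filter_eq_nil_iff.2 (by simpa using h1), List.append_nil]
  · rw [List.filter_append, List.filter_eq_nil_iff.2 (by simpa using h2),
      List.filter_eq_self.2 (by simpa using h1), List.nil_append]

theorem exists_append_of_factorizationsOn {s : Set (LyndonWord d)} {a : LyndonWord d}
    (ha : ∀ u ∈ s, u < a) {n : ℕ} {W : List (List X)}
    (hW : W ∈ factorizationsOn c (insert a s) n) :
    ∃ i j, i + j = n ∧ ∃ g ∈ factorizationsOn c {a} i, ∃ W' ∈ factorizationsOn c s j,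
      g ++ W' = W := by
  have hle : ∀ x ∈ W, x.map c ≤ a.1 := by
    intro x hx
    obtain ⟨u, hu, h⟩ := hW.2.1 x hx
    rw [h]
    rcases hu with rfl | hu
    · exact le_refl _
    · exact (ha u hu).le
  have happ := filter_colour_append hW.1.2 hle
  refine ⟨_, _, ?_, W.filter (fun x => x.map c = a.1), ⟨⟨?_, hW.1.2.filter _⟩, ?_, rfl⟩,
    W.filter (fun x => ¬ x.map c = a.1), ⟨⟨?_, hW.1.2.filter _⟩, ?_, rfl⟩, happ⟩
  · rw [← List.length_append, ← List.flatten_append, happ, hW.2.2]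
  · exact fun x hx => hW.1.1 x (List.mem_of_mem_filter hx)
  · intro x hx
    exact ⟨a, rfl, by simpa using (List.mem_filter.1 hx).2⟩
  · exact fun x hx => hW.1.1 x (List.mem_of_mem_filter hx)
  · intro x hx
    have hx := List.mem_filter.1 hx
    obtain ⟨u, hu, h⟩ := hW.2.1 x hx.1
    rcases hu with rfl | hu
    · exact absurd h (by simpa using hx.2)
    · exact ⟨u, hu, h⟩

/-- As `a` is larger than every element of `s`, the factors of colour `a` come first. Cutting after
them is a bijection onto pairs of factorizations whose lengths add up to `n`. -/
theorem card_factorizationsOn_insert [Finite X] {s : Set (LyndonWord d)} {a : LyndonWord d}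
    (ha : ∀ u ∈ s, u < a) (n : ℕ) :
    Nat.card (factorizationsOn c (insert a s) n) = ∑ p ∈ Finset.HasAntidiagonal.antidiagonal n,
      Nat.card (factorizationsOn c {a} p.1) * Nat.card (factorizationsOn c s p.2) := by
  have (s : Set (LyndonWord d)) (n : ℕ) : Finite (factorizationsOn c s n) :=
    finite_factorizationsOn c s n
  let F : (Σ p : Finset.HasAntidiagonal.antidiagonal n,
      factorizationsOn c {a} p.1.1 × factorizationsOn c s p.1.2) →
      factorizationsOn c (insert a s) n := fun q =>
    ⟨q.2.1.1 ++ q.2.2.1, by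
      have h := append_mem_factorizationsOn ha q.2.1.2 q.2.2.2
      rwa [Finset.HasAntidiagonal.mem_antidiagonal.1 q.1.2] at h⟩
  have hF : Function.Bijective F := by
    constructor
    · rintro ⟨⟨⟨i, j⟩, hp⟩, ⟨g, hg⟩, ⟨W, hW⟩⟩ ⟨⟨⟨i', j'⟩, hp'⟩, ⟨g', hg'⟩, ⟨W', hW'⟩⟩ h
      have h : g ++ W = g' ++ W' := congrArg Subtype.val h
      have h1 := filter_append_of_factorizationsOn ha hg hW
      have h2 := filter_append_of_factorizationsOn ha hg' hW'
      rw [h] at h1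
      obtain rfl := h1.1.symm.trans h2.1
      obtain rfl := h1.2.symm.trans h2.2
      obtain rfl : i = i' := hg.2.2.symm.trans hg'.2.2
      obtain rfl : j = j' := hW.2.2.symm.trans hW'.2.2
      rfl
    · rintro ⟨W, hW⟩
      obtain ⟨i, j, hij, g, hg, W', hW', h⟩ := exists_append_of_factorizationsOn ha hW
      exact ⟨⟨⟨(i, j), Finset.HasAntidiagonal.mem_antidiagonal.2 hij⟩, ⟨g, hg⟩, ⟨W', hW'⟩⟩, Subtype.ext h⟩
  rw [← Nat.card_eq_of_bijective F hF, Nat.card_sigma]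
  simp only [Nat.card_prod]
  exact Finset.sum_coe_sort (Finset.HasAntidiagonal.antidiagonal n) fun p =>
    Nat.card (factorizationsOn c {a} p.1) * Nat.card (factorizationsOn c s p.2)

/-- Adding the Lyndon words in increasing order makes each new one the maximum, so the convolution
formula for the counts applies. The empty product counts only the empty factorization. -/
theorem prod_mk_card_factorizationsOn [Finite X] (s : Finset (LyndonWord d)) :
    ∏ u ∈ s, (PowerSeries.mk fun n => (Nat.card (factorizationsOn c {u} n) : ℤ)) =
      PowerSeries.mk fun n => (Nat.card (factorizationsOn c (s : Set (LyndonWord d)) n) : ℤ) := by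
  induction s using Finset.induction_on_max with
  | empty =>
    ext n
    have h (n : ℕ) : factorizationsOn c ((∅ : Finset (LyndonWord d)) : Set (LyndonWord d)) n =
        if n = 0 then {[]} else ∅ := by
      ext W
      have h0 : W ∈ factorizationsOn c ((∅ : Finset (LyndonWord d)) : Set (LyndonWord d)) n ↔
          W = [] ∧ n = 0 := by
        constructor
        · rintro ⟨-, h1, h2⟩
          cases W with
          | nil => exact ⟨rfl, h2.symm⟩
          | cons x W => simpa using h1 x (by simp)
        · rintro ⟨rfl, rfl⟩
          exact ⟨⟨by simp, List.Pairwise.nil⟩, by simp, rfl⟩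
      rw [h0]
      split_ifs with hn <;> simp [hn]
    rw [Finset.prod_empty, PowerSeries.coeff_mk, h, PowerSeries.coeff_one]
    split_ifs <;> simp
  | insert a s ha ih =>
    rw [Finset.prod_insert fun h => (ha a h).false, ih]
    ext n
    rw [PowerSeries.coeff_mul, PowerSeries.coeff_mk, Finset.coe_insert,
      card_factorizationsOn_insert (fun u hu => ha u hu)]
    simp

/-- A factorization of total length `n` uses only Lyndon words of length at most `n`, of which there
are finitely many. Once a finite set contains them all, the coefficient of `tⁿ` in the partial
product no longer changes. -/
theorem hasProd_mk_card_factorizationsOn [Finite X] :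
    HasProd (fun u : LyndonWord d =>
      (PowerSeries.mk fun n => (Nat.card (factorizationsOn c {u} n) : ℤ)))
      (PowerSeries.mk fun n => (Nat.card (factorizationsOn c Set.univ n) : ℤ)) := by
  refine (PowerSeries.WithPiTopology.tendsto_iff_coeff_tendsto _ _ _ _).2 fun n => ?_
  simp only [prod_mk_card_factorizationsOn, PowerSeries.coeff_mk]
  have hfin : {u : LyndonWord d | u.1.length ≤ n}.Finite := by
    refine Set.Finite.of_finite_image (f := Subtype.val)
      ((List.finite_length_le (Fin d) n).subset ?_) Subtype.val_injective.injOn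
    rintro _ ⟨u, hu, rfl⟩
    exact hu
  refine tendsto_const_nhds.congr' ?_
  rw [SummationFilter.unconditional_filter]
  filter_upwards [Filter.eventually_ge_atTop hfin.toFinset] with s hs
  congr 3
  ext W
  refine ⟨fun hW => ⟨hW.1, fun x hx => ?_, hW.2.2⟩, fun hW => ⟨hW.1, fun x hx => ?_, hW.2.2⟩⟩
  · obtain ⟨u, -, h⟩ := hW.2.1 x hx
    refine ⟨u, hs ?_, h⟩
    rw [Set.Finite.mem_toFinset, Set.mem_ofPred_eq, ← h, List.length_map, ← hW.2.2,
      List.length_flatten]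
    exact List.single_le_sum (by simp) _ (List.mem_map_of_mem hx)
  · obtain ⟨u, -, h⟩ := hW.2.1 x hx
    exact ⟨u, trivial, h⟩

end Counting

/-! ### Hilbert series -/

section HilbertSeries

theorem span_image_inf_span_image {k M ι : Type*} [Field k] [AddCommGroup M] [Module k M]
    (b : Module.Basis ι k M) (s t : Set ι) :
    Submodule.span k (b '' s) ⊓ Submodule.span k (b '' t) = Submodule.span k (b '' (s ∩ t)) := by
  ext x
  simp only [Submodule.mem_inf, b.mem_span_image, Set.subset_inter_iff]

theorem finrank_span_image {k M ι : Type*} [Field k] [AddCommGroup M] [Module k M]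
    (b : Module.Basis ι k M) (s : Set ι) [Finite s] :
    Module.finrank k (Submodule.span k (b '' s)) = Nat.card s := by
  have := Fintype.ofFinite s
  have h := finrank_span_eq_card (b.linearIndependent.comp (Subtype.val : s → ι)
    Subtype.val_injective)
  rw [Set.image_eq_range, Nat.card_eq_fintype_card, ← h]
  rfl

variable {k : Type u} {H : Type v} [Field k] [Ring H] [HopfAlgebra k H] {d : ℕ}
  {V : Fin d → YDMod k H} {η : Fin d → Type w} (b : ∀ i, Module.Basis (η i) k (V i))
  (hS : Function.Bijective (HopfAlgebra.antipode k (A := H)))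

theorem finrank_span_pbwBasis [∀ i, Finite (η i)] (s : Set (LyndonWord d)) (n : ℕ) :
    Module.finrank k (Submodule.span k (pbwBasis b hS ''
      {W | W.1 ∈ factorizationsOn Sigma.fst s n})) =
      Nat.card (factorizationsOn (Sigma.fst : (Σ i, η i) → Fin d) s n) := by
  let e : {W : lyndonFactorizations (Sigma.fst : (Σ i, η i) → Fin d) |
      W.1 ∈ factorizationsOn Sigma.fst s n} ≃
      factorizationsOn (Sigma.fst : (Σ i, η i) → Fin d) s n :=
    { toFun := fun W => ⟨W.1.1, W.2⟩
      invFun := fun W => ⟨⟨W.1, W.2.1⟩, W.2⟩ }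
  have : Finite (factorizationsOn (Sigma.fst : (Σ i, η i) → Fin d) s n) :=
    finite_factorizationsOn _ s n
  have := Finite.of_equiv _ e.symm
  rw [finrank_span_image, Nat.card_congr e]

theorem hilbertSeries_tensorGrading [∀ i, Finite (η i)]
    (b : ∀ i, Module.Basis (η i) k (V i))
    (hS : Function.Bijective (HopfAlgebra.antipode k (A := H))) :
    hilbertSeries (tensorGrading (k := k) (YDMod.directSum V)) = PowerSeries.mk fun n =>
      (Nat.card (factorizationsOn (Sigma.fst : (Σ i, η i) → Fin d) Set.univ n) : ℤ) := by
  ext n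
  rw [hilbertSeries, PowerSeries.coeff_mk, PowerSeries.coeff_mk, tensorGrading_eq_span b hS,
    ← finrank_span_pbwBasis b hS]
  have h : {W : lyndonFactorizations (Sigma.fst : (Σ i, η i) → Fin d) |
      W.1.flatten.length = n} = {W | W.1 ∈ factorizationsOn Sigma.fst Set.univ n} := by
    ext W
    exact ⟨fun h => ⟨W.2, fun x hx => ⟨⟨_, W.2.1 x hx⟩, trivial, rfl⟩, h⟩, fun h => h.2.2⟩
  rw [h]

/-- The subalgebra is spanned by the products of its generators `[x]` with `x` of colour `u`. A
constant sequence of colours is nonincreasing, so every such product is itself a basis element of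
`TV`. -/
theorem lyndonSubalgebra_eq_span (u : LyndonWord d) :
    Subalgebra.toSubmodule (lyndonSubalgebra hS V u) = Submodule.span k (pbwBasis b hS ''
      {W | ∀ x ∈ W.1, x.map Sigma.fst = u.1}) := by
  rw [lyndonSubalgebra, TensorAlgebra.range_lift, Submodule.coe_subtype, Subtype.range_coe,
    range_wordBracket b, Algebra.adjoin_span, Algebra.adjoin_eq_span]
  congr 1
  ext y
  constructor
  · intro hy
    obtain ⟨l, hl, rfl⟩ := Submonoid.exists_list_of_mem_closure hy
    have : ∃ W : List (List (Σ i, η i)), (∀ x ∈ W, x.map Sigma.fst = u.1) ∧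
        W.map (bracketWord b hS) = l := by
      clear hy
      induction l with
      | nil => exact ⟨[], by simp, rfl⟩
      | cons y l ih =>
        obtain ⟨W, hW, rfl⟩ := ih fun z hz => hl z (by simp [hz])
        obtain ⟨x, hx, rfl⟩ := hl y (by simp)
        refine ⟨x :: W, fun z hz => ?_, rfl⟩
        rcases List.mem_cons.1 hz with rfl | hz
        · exact hx
        · exact hW z hz
    obtain ⟨W, hW, rfl⟩ := this
    refine ⟨⟨W, fun x hx => ?_, List.pairwise_of_forall_mem_list fun x hx y hy => ?_⟩, hW,
      pbwBasis_apply b hS _⟩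
    · rw [hW x hx]
      exact u.2
    · rw [hW x hx, hW y hy]
  · rintro ⟨W, hW, rfl⟩
    rw [pbwBasis_apply]
    refine Submonoid.list_prod_mem _ fun y hy => ?_
    obtain ⟨x, hx, rfl⟩ := List.mem_map.1 hy
    exact Submonoid.subset_closure ⟨x, hW x hx, rfl⟩

/-- The subalgebra and the degree `n` part of `TV` are spanned by subsets of one basis, so their
intersection is spanned by the common elements, and its dimension is their number. -/
theorem hilbertSeries_lyndonGrading [∀ i, Finite (η i)]
    (b : ∀ i, Module.Basis (η i) k (V i)) (u : LyndonWord d) :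
    hilbertSeries (lyndonGrading hS V u) = PowerSeries.mk fun n =>
      (Nat.card (factorizationsOn (Sigma.fst : (Σ i, η i) → Fin d) {u} n) : ℤ) := by
  ext n
  rw [hilbertSeries, PowerSeries.coeff_mk, PowerSeries.coeff_mk, ← finrank_span_pbwBasis b hS]
  have hinj : Function.Injective (lyndonSubalgebra hS V u).val.toLinearMap :=
    Subtype.val_injective
  -- The component is carried into `TV`, where it becomes the intersection of the subalgebra with
  -- the degree `n` part.
  rw [((lyndonGrading hS V u n).equivMapOfInjective _ hinj).finrank_eq, lyndonGrading,
    Submodule.map_comap_eq]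
  have h1 : LinearMap.range (lyndonSubalgebra hS V u).val.toLinearMap =
      Subalgebra.toSubmodule (lyndonSubalgebra hS V u) := by
    ext x
    exact ⟨fun ⟨y, hy⟩ => hy ▸ y.2, fun hx => ⟨⟨x, hx⟩, rfl⟩⟩
  have h2 : {W : lyndonFactorizations (Sigma.fst : (Σ i, η i) → Fin d) |
      ∀ x ∈ W.1, x.map Sigma.fst = u.1} ∩ {W | W.1.flatten.length = n} =
      {W | W.1 ∈ factorizationsOn Sigma.fst {u} n} := by
    ext W
    refine ⟨fun h => ⟨W.2, fun x hx => ⟨u, rfl, h.1 x hx⟩, h.2⟩, fun h => ⟨fun x hx => ?_, h.2.2⟩⟩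
    obtain ⟨_, rfl, hx⟩ := h.2.1 x hx
    exact hx
  rw [h1, lyndonSubalgebra_eq_span b hS, tensorGrading_eq_span b hS, span_image_inf_span_image, h2]

end HilbertSeries

end YetterDrinfeld

theorem mainTheorem4 {k : Type u} {H : Type v} [Field k] [Ring H] [HopfAlgebra k H]
    (hS : Function.Bijective (HopfAlgebra.antipode k (A := H)))
    {d : ℕ} (V : Fin d → YDMod k H) :
    (∃ e : YDIso (YDMod.ordProd fun u : LyndonWord d => (lyndonSpace hS V u).tensorPlus)
        (YDMod.directSum V).tensorPlus,
      ∀ x, (e.toEquiv x : TensorAlgebra k (YDMod.directSum V)) = multiplicationMap hS V x) ∧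
    ((∀ i, Module.Finite k (V i)) →
      HasProd (fun u : LyndonWord d => hilbertSeries (lyndonGrading hS V u))
        (hilbertSeries (tensorGrading (k := k) (YDMod.directSum V)))) := by
  refine ⟨exists_ydIso_multiplicationMap hS V, fun hV => ?_⟩
  have b := fun i => Module.finBasis k (V i)
  rw [hilbertSeries_tensorGrading b hS, funext (hilbertSeries_lyndonGrading hS b)]
  exact hasProd_mk_card_factorizationsOn
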